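/- Let $k\ge 1$. A \emph{$k$-coin model} $\mathcal M=(\alpha,w)$ consists of biases $\alpha_1,\dots,\alpha_k\in[0,1]$ and weights $w_1,\dots,w_k\ge 0$ with $\sum_i w_i=1$; it is identified with the probability measure $\sum_i w_i\delta_{\alpha_i}$ on $[0,1]$. Its separation is $\min_{i\ne j}|\alpha_i-\alpha_j|$ (taken to be $+\infty$ if $k=1$). A \emph{$2k$-snapshot} of $\mathcal M$ is a sample from $\sum_i w_i\,\mathrm{Bin}(2k,\alpha_i)$. $W$ denotes the ($L^1$-)Wasserstein, or transportation, distance of measures on $[0,1]$. Given $k$, lower bounds $\zeta\in(0,1]$ on the separation and $w_{\min}>0$ on the weights, an accuracy parameter $\gamma\ge 1$, and the normalized histogram $h=(h_0,\dots,h_{2k})$ of a sample of $2k$-snapshots, where $h_j$ is the fraction of snapshots equal to $j$, the algorithm \textsc{LearnCoinMixture} proceeds as follows. (1) Compute $\tilde\mu_i=\sum_{j=i}^{2k}\binom ji\binom{2k}i^{-1}h_j$ for $0\le i\le 2k$, and the Hankel matrix $\tilde{\mathcal H}=(\tilde\mu_{i+j})_{0\le i,j\le k}$. (2) Compute a vector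 $v\in\mathbb R^{k+1}$ within Euclidean distance $w_{\min}2^{-\gamma}(\zeta/16)^{2k}$ of some minimizer of $z^{\mathsf T}\tilde{\mathcal H}z$ over the unit sphere. (3) Compute approximations $\tilde\beta_1,\dots,\tilde\beta_k\in\mathbb C$ of the $k$ complex roots (with multiplicity) of $\hat v(x)=\sum_{j=0}^k v_jx^j$, each with error at most $\frac1{6k}2^{-\gamma}(\zeta/2)^k$ (arbitrary numbers if $v_k=0$). (4) Let $\tilde\alpha_i$ be the Euclidean projection of $\tilde\beta_i$ onto $[0,1]$. (5) Compute $w'=V_{\tilde\alpha}^{-1}(\tilde\mu_0,\dots,\tilde\mu_{k-1})^{\mathsf T}$, where $V_{\tilde\alpha}=(\tilde\alpha_j^{\,i})_{0\le i\le k-1,\,1\le j\le k}$; put $W^-=\sum_{i:\,w'_i<0}w'_i$, $W^+=\sum_{i:\,w'_i\ge0}w'_i$, and let $\tilde w_i=0$ if $w'_i<0$ and $\tilde w_i=w'_i(1+W^- /W^+)$ otherwise. (6) Output $(\tilde\alpha,\tilde w)$. \textbf{Corollary.} There is an absolute constant $C>0$ such that the following holds for every $k\geq 1$, every $k$-coin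 model $\mathcal M$, every $\zeta\in(0,1]$ that is at most the separation of $\mathcal M$, every $w_{\min}>0$ that is at most every weight of $\mathcal M$, every real $\gamma\ge1$, and every integer $$s\ \ge\ w_{\min}^{-2}\cdot 2^{C(k+\gamma)}\cdot\zeta^{-Ck}.$$ If the algorithm is run on the normalized histogram of $s$ independent $2k$-snapshots of $\mathcal M$, then with probability at least $0.99$ over the sample it has an output, and every possible output $\tilde{\mathcal M}=(\tilde\alpha,\tilde w)$ (however the approximations in (2) and (3) are chosen) is a $k$-coin model with $$W(\mathcal M,\tilde{\mathcal M})\ \le\ (k+1)\cdot 2^{-\gamma}.$$ -/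

import Mathlib

open MeasureTheory ProbabilityTheory
open scoped ENNReal unitInterval Matrix

noncomputable section

namespace CoinMixture

/-- A `k`-coin model: a mixture of `k` Bernoulli variables with success probabilities `bias i`
and mixing weights `weight i`. -/
structure CoinModel (k : ℕ) where
  bias : Fin k → I
  weight : Fin k → ℝ
  weight_nonneg : ∀ i, 0 ≤ weight i
  weight_sum : ∑ i, weight i = 1

namespace CoinModel

variable {k : ℕ}

/-- The separation `min_{i ≠ j} |α i - α j|`, as an extended nonnegative real
(it is `∞` if there is a single coin, where the minimum is over the empty set). -/
def separation (M : CoinModel k) : ℝ≥0∞ :=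
  ⨅ (i : Fin k) (j : Fin k) (_ : i ≠ j), edist (M.bias i) (M.bias j)

/-- The least mixing weight. -/
def minWeight (M : CoinModel k) : ℝ := ⨅ i, M.weight i

/-- The mixing measure `∑ i, w i • δ_{α i}` on `[0,1]`. -/
def toMeasure (M : CoinModel k) : Measure I :=
  ∑ i, ENNReal.ofReal (M.weight i) • Measure.dirac (M.bias i)

/-- The law of an `m`-snapshot: the mixture of the binomial distributions `Bin(m, α i)` with
weights `w i`. -/
def snapshotLaw (M : CoinModel k) (m : ℕ) : Measure ℕ :=
  ∑ i, ENNReal.ofReal (M.weight i) • binomial m (M.bias i)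

/-- The law of `s` independent `m`-snapshots. -/
def sampleLaw (M : CoinModel k) (m s : ℕ) : Measure (Fin s → ℕ) :=
  Measure.pi fun _ => M.snapshotLaw m

theorem sum_ofReal_weight (M : CoinModel k) : ∑ i, ENNReal.ofReal (M.weight i) = 1 := by
  rw [← ENNReal.ofReal_sum_of_nonneg fun i _ => M.weight_nonneg i, M.weight_sum,
    ENNReal.ofReal_one]

instance (M : CoinModel k) : IsProbabilityMeasure M.toMeasure :=
  ⟨by simp [toMeasure, sum_ofReal_weight]⟩

instance (M : CoinModel k) (m : ℕ) : IsProbabilityMeasure (M.snapshotLaw m) :=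
  ⟨by simp [snapshotLaw, sum_ofReal_weight]⟩

instance (M : CoinModel k) (m s : ℕ) : IsProbabilityMeasure (M.sampleLaw m s) := by
  unfold sampleLaw; infer_instance

end CoinModel

/-- The Wasserstein (transportation) distance: the infimum of `∫ d(x, y) dπ(x, y)` over all
couplings `π` of `μ` and `ν`. -/
def wasserstein {X : Type*} [PseudoEMetricSpace X] [MeasurableSpace X] (μ ν : Measure X) : ℝ≥0∞ :=
  ⨅ (π : Measure (X × X)) (_ : π.fst = μ) (_ : π.snd = ν), ∫⁻ p, edist p.1 p.2 ∂π

/-! ### The algorithm -/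

/-- The normalized histogram of a sample: the fraction of the samples that are equal to `j`. -/
def histogram (m : ℕ) {s : ℕ} (x : Fin s → ℕ) (j : Fin (m + 1)) : ℝ :=
  (Finset.univ.filter fun t => x t = (j : ℕ)).card / s

/-- The matrix that converts a normalized histogram of `2k`-snapshots to moments. -/
def pascal (k : ℕ) : Matrix (Fin (2 * k + 1)) (Fin (2 * k + 1)) ℝ :=
  Matrix.of fun i j =>
    if i ≤ j then ((j : ℕ).choose i : ℝ) / ((2 * k).choose i : ℝ) else 0

/-- The `(k+1) × (k+1)` Hankel matrix of a moment vector `μ 0, …, μ (2k)`. -/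
def hankel {k : ℕ} (μ : Fin (2 * k + 1) → ℝ) : Matrix (Fin (k + 1)) (Fin (k + 1)) ℝ :=
  Matrix.of fun i j => μ ⟨(i : ℕ) + j, by omega⟩

/-- `v` is within Euclidean distance `ε` of a minimizer of `z ↦ zᵀ H z` over the unit sphere. -/
def IsApproxArgmin {n : ℕ} (ε : ℝ) (H : Matrix (Fin n) (Fin n) ℝ)
    (v : EuclideanSpace ℝ (Fin n)) : Prop :=
  ∃ u ∈ Metric.sphere (0 : EuclideanSpace ℝ (Fin n)) 1,
    IsMinOn (fun z : EuclideanSpace ℝ (Fin n) => z.ofLp ⬝ᵥ (H *ᵥ z.ofLp)) (Metric.sphere 0 1) u ∧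
      dist v u ≤ ε

/-- The polynomial `∑ j, v j x ^ j` associated with a vector, over `ℂ`. -/
def vectorPoly {n : ℕ} (v : EuclideanSpace ℝ (Fin n)) : Polynomial ℂ :=
  ∑ j : Fin n, Polynomial.monomial (j : ℕ) ((v j : ℝ) : ℂ)

/-- `b` lists the `k` complex roots of the polynomial of `v`, with multiplicity and in some order,
each up to an error of at most `ε`. If the degree drops below `k`, there are no `k` roots to
approximate, and then nothing is required of `b`. -/
def IsApproxRoots {k : ℕ} (ε : ℝ) (v : EuclideanSpace ℝ (Fin (k + 1))) (b : Fin k → ℂ) : Prop :=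
  v (Fin.last k) ≠ 0 →
    ∃ β : Fin k → ℂ, (vectorPoly v).roots = Finset.univ.val.map β ∧ ∀ i, ‖b i - β i‖ ≤ ε

/-- The Euclidean projection of a complex number onto the interval `[0,1]`: its real part,
clamped to `[0,1]`. -/
def projUnit (z : ℂ) : I := Set.projIcc 0 1 zero_le_one z.re

/-- The weights obtained by solving the square Vandermonde system `V_a w = (μ 0, …, μ (k-1))`,
where the columns of `V_a` are `(1, a j, …, a j ^ (k-1))`. -/
def vandermondeWeights {k : ℕ} (a : Fin k → I) (μ : Fin (2 * k + 1) → ℝ) : Fin k → ℝ :=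
  ((Matrix.vandermonde fun i => (a i : ℝ))ᵀ)⁻¹ *ᵥ fun i : Fin k => μ ⟨i, by omega⟩

/-- Negative weights are replaced by `0`, and the other ones are rescaled by `1 + W⁻ / W⁺`, where
`W⁻` and `W⁺` are the sums of the negative and of the nonnegative weights. -/
def rectifyWeights {k : ℕ} (w : Fin k → ℝ) (i : Fin k) : ℝ :=
  if w i < 0 then 0
  else w i * (1 + (∑ j with w j < 0, w j) / (∑ j with 0 ≤ w j, w j))

/-- `(a, b)` is a possible output (biases, weights) of the algorithm on the input `k`, `ζ`, `w`,
`γ` and the histogram `h`. The only freedom is in the two approximate computations. -/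
def IsOutput (k : ℕ) (ζ w γ : ℝ) (h : Fin (2 * k + 1) → ℝ) (a : Fin k → I) (b : Fin k → ℝ) :
    Prop :=
  ∃ (v : EuclideanSpace ℝ (Fin (k + 1))) (r : Fin k → ℂ),
    IsApproxArgmin (w * 2 ^ (-γ) * (ζ / 16) ^ (2 * k)) (hankel (pascal k *ᵥ h)) v ∧
    IsApproxRoots (1 / (6 * k) * 2 ^ (-γ) * (ζ / 2) ^ k) v r ∧
    a = (fun i => projUnit (r i)) ∧
    b = rectifyWeights (vandermondeWeights a (pascal k *ᵥ h))

end CoinMixture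

end

/-! The argument separates probability from deterministic stability. The falling-factorial statistic
of one `2k`-snapshot is an unbiased `[0,1]`-valued estimator of a moment, and the Pascal transform
of the histogram averages it. Chebyshev and a union bound put all `2k+1` empirical moments within a
tolerance `η` of the true ones (`measureReal_moments_close`). On that event every output is good,
whatever approximations were chosen (`exists_model_of_isOutput`).

Biases: the true Hankel form of `z` is `∑ w_l p_z(α_l)^2`, which vanishes at the normalized
coefficients of `∏ (x - α_l)`. A minimizer of the perturbed form therefore gives a polynomial that
is tiny at every `α_l`. Separation and Lagrange interpolation keep its leading coefficient at least
about `2^(-k)`, since otherwise all coefficients would be small, against unit norm. So `∏_j |α_l -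
β_j|` is tiny for each `l`, which forces a matching between roots and biases
(`exists_perm_of_prod_le`).

Weights: the inverse Vandermonde matrix consists of Lagrange basis coefficients. Its effect on
moment noise, and on the displacement of the nodes, costs a power `k-1` of a multiple of `1/ζ`,
which the accuracies in the algorithm and in `η` absorb. Rectification at most triples the `ℓ¹`
error, and an explicit coupling turns bias and weight errors into a Wasserstein bound. -/

noncomputable section

namespace CoinMixture

/-! ### Concentration of the empirical moments -/

/-- The value at `n` of the unbiased estimator of the `i`-th moment from an `m`-snapshot. -/
def momentEstimator (m i n : ℕ) : ℝ := if n ≤ m then (n.choose i : ℝ) / m.choose i else 0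

/-- The moments of a coin model. -/
def CoinModel.moment {k : ℕ} (M : CoinModel k) (i : ℕ) : ℝ :=
  ∑ j, M.weight j * (M.bias j : ℝ) ^ i

theorem momentEstimator_mem_Icc (m i n : ℕ) : momentEstimator m i n ∈ Set.Icc (0 : ℝ) 1 := by
  unfold momentEstimator
  split_ifs with h
  · refine ⟨by positivity, div_le_one_of_le₀ ?_ (by positivity)⟩
    exact_mod_cast Nat.choose_le_choose i h
  · simp

/-- The identity `C(N,j) C(j,i) = C(N,i) C(N-i,j-i)` reduces the sum to `p^i (p + (1-p))^(N-i)`.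
This is the unbiasedness of the estimator for a single coin. -/
theorem sum_choose_mul_choose_mul_pow {N i : ℕ} (hi : i ≤ N) (p : ℝ) :
    ∑ j ∈ Finset.range (N + 1), (N.choose j * p ^ j * (1 - p) ^ (N - j)) * (j.choose i : ℝ) =
      N.choose i * p ^ i := by
  obtain ⟨d, rfl⟩ := Nat.exists_eq_add_of_le hi
  rw [add_assoc, Finset.sum_range_add, Finset.sum_eq_zero, zero_add]
  · have h := add_pow p (1 - p) d
    rw [add_sub_cancel, one_pow] at h
    refine Eq.trans ?_ (mul_one _)
    conv_rhs => rw [h, Finset.mul_sum]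
    refine Finset.sum_congr rfl fun j hj => ?_
    have hj' : j ≤ d := Nat.lt_succ_iff.1 (Finset.mem_range.1 hj)
    have hc := Nat.choose_mul (n := i + d) (k := i + j) (s := i)
    rw [Nat.add_sub_cancel_left, Nat.add_sub_cancel_left] at hc
    have hc' : ((i + d).choose (i + j) : ℝ) * (i + j).choose i =
        (i + d).choose i * d.choose j := by exact_mod_cast hc (by omega)
    rw [Nat.add_sub_add_left, pow_add]
    linear_combination (p ^ i * p ^ j * (1 - p) ^ (d - j)) * hc'
  · intro j hj
    rw [Nat.choose_eq_zero_of_lt (Finset.mem_range.1 hj)]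
    simp

theorem integral_momentEstimator_binomial {m i : ℕ} (hi : i ≤ m) (p : I) :
    ∫ n, momentEstimator m i n ∂(binomial m p) = (p : ℝ) ^ i := by
  have h0 : (m.choose i : ℝ) ≠ 0 := by exact_mod_cast (Nat.choose_pos hi).ne'
  rw [integral_binomial, ← mul_right_inj' h0, ← sum_choose_mul_choose_mul_pow hi, Finset.mul_sum]
  have : Finset.Iic m = Finset.range (m + 1) := by ext; simp
  rw [this]
  refine Finset.sum_congr rfl fun j hj => ?_
  rw [momentEstimator, if_pos (Nat.lt_succ_iff.1 (Finset.mem_range.1 hj)), smul_eq_mul]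
  field_simp

theorem integrable_snapshotLaw {k : ℕ} (M : CoinModel k) (m : ℕ) (f : ℕ → ℝ) :
    Integrable f (M.snapshotLaw m) := by
  unfold CoinModel.snapshotLaw
  rw [integrable_finsetSum_measure]
  exact fun i _ => (integrable_binomial f).smul_measure ENNReal.ofReal_ne_top

theorem integral_momentEstimator_snapshotLaw {k : ℕ} (M : CoinModel k) {m i : ℕ} (hi : i ≤ m) :
    ∫ n, momentEstimator m i n ∂(M.snapshotLaw m) = M.moment i := by
  unfold CoinModel.snapshotLaw CoinModel.moment
  rw [integral_finsetSum_measure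
    fun i _ => (integrable_binomial _).smul_measure ENNReal.ofReal_ne_top]
  refine Finset.sum_congr rfl fun j _ => ?_
  rw [integral_smul_measure, integral_momentEstimator_binomial hi,
    ENNReal.toReal_ofReal (M.weight_nonneg j), smul_eq_mul]

theorem ae_le_snapshotLaw {k : ℕ} (M : CoinModel k) (m : ℕ) :
    ∀ᵐ n ∂(M.snapshotLaw m), n ≤ m := by
  have h (p : I) : ∀ᵐ n ∂(binomial m p), n ≤ m := ae_le_of_hasLaw_binomial HasLaw.id
  rw [ae_iff, CoinModel.snapshotLaw, Measure.finsetSum_apply]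
  refine Finset.sum_eq_zero fun i _ => ?_
  rw [Measure.smul_apply, ae_iff.1 (h _), smul_zero]

theorem ae_le_sampleLaw {k : ℕ} (M : CoinModel k) (m s : ℕ) :
    ∀ᵐ x ∂(M.sampleLaw m s), ∀ t, x t ≤ m := by
  rw [ae_all_iff]
  intro t
  exact (measurePreserving_eval (fun _ : Fin s => M.snapshotLaw m) t).quasiMeasurePreserving.ae
    (ae_le_snapshotLaw M m)

theorem pascal_mulVec_histogram (k : ℕ) {s : ℕ} (x : Fin s → ℕ) (i : Fin (2 * k + 1)) :
    (pascal k *ᵥ histogram (2 * k) x) i = (∑ t, momentEstimator (2 * k) i (x t)) / s := by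
  have h1 (j : Fin (2 * k + 1)) : pascal k i j * histogram (2 * k) x j =
      (∑ t, if x t = (j : ℕ) then momentEstimator (2 * k) i (x t) else 0) / s := by
    have hp : pascal k i j = momentEstimator (2 * k) i j := by
      rw [momentEstimator, if_pos (Nat.lt_succ_iff.1 j.2)]
      simp only [pascal, Matrix.of_apply]
      split_ifs with h
      · rfl
      · rw [Nat.choose_eq_zero_of_lt (not_le.1 h)]
        simp
    rw [hp, histogram, ← Finset.sum_filter, ← mul_div_assoc]
    congr 1
    rw [Finset.sum_congr rfl (g := fun _ => momentEstimator (2 * k) i j), Finset.sum_const,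
      nsmul_eq_mul, mul_comm]
    intro t ht
    rw [(Finset.mem_filter.1 ht).2]
  simp only [Matrix.mulVec, dotProduct, h1]
  rw [← Finset.sum_div, Finset.sum_comm]
  congr 1
  refine Finset.sum_congr rfl fun t _ => ?_
  -- A value above `2k` is counted by no histogram entry, in agreement with the default value `0` of
  -- `momentEstimator`.
  by_cases h : x t ≤ 2 * k
  · rw [Finset.sum_eq_single ⟨x t, Nat.lt_succ_iff.2 h⟩] <;> simp
    intro b hb hb'
    exact absurd (Fin.ext hb'.symm) hb
  · rw [momentEstimator, if_neg h]
    simp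

/-- Independence makes the variance additive. A `[0,1]`-valued variable has variance at most `1/4`,
and the cruder `1` per snapshot suffices. -/
theorem variance_sum_momentEstimator_le {k : ℕ} (M : CoinModel k) (m i s : ℕ) :
    Var[fun x => ∑ t, momentEstimator m i (x t); M.sampleLaw m s] ≤ s := by
  have h (t : Fin s) : MemLp (momentEstimator m i) 2 (M.snapshotLaw m) :=
    MemLp.of_bound (Measurable.of_discrete).aestronglyMeasurable 1 (Filter.Eventually.of_forall
      fun n => by
        rw [Real.norm_of_nonneg (momentEstimator_mem_Icc m i n).1]
        exact (momentEstimator_mem_Icc m i n).2)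
  have h2 := variance_sum_pi h
  have h3 : (∑ t : Fin s, fun x : Fin s → ℕ => momentEstimator m i (x t)) =
      fun x => ∑ t, momentEstimator m i (x t) := by
    ext x; simp
  rw [h3] at h2
  rw [CoinModel.sampleLaw, h2, Finset.sum_const, Finset.card_univ, Fintype.card_fin, nsmul_eq_mul]
  have h4 := variance_le_sq_of_bounded (μ := M.snapshotLaw m) (X := momentEstimator m i)
    (Filter.Eventually.of_forall (momentEstimator_mem_Icc m i))
    (Measurable.of_discrete).aemeasurable
  have : (0 : ℝ) ≤ s := by positivity
  nlinarith

theorem integral_sum_momentEstimator {k : ℕ} (M : CoinModel k) {m i : ℕ} (hi : i ≤ m) (s : ℕ) :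
    ∫ x, ∑ t, momentEstimator m i (x t) ∂(M.sampleLaw m s) = s * M.moment i := by
  have hp (t : Fin s) := measurePreserving_eval (fun _ : Fin s => M.snapshotLaw m) t
  have hI (t : Fin s) : Integrable (fun x : Fin s → ℕ => momentEstimator m i (x t))
      (M.sampleLaw m s) :=
    (hp t).integrable_comp_of_integrable (integrable_snapshotLaw M m (momentEstimator m i))
  rw [integral_finsetSum _ fun t _ => hI t]
  have h1 (t : Fin s) : ∫ x, momentEstimator m i (x t) ∂(M.sampleLaw m s) = M.moment i := by
    rw [← integral_momentEstimator_snapshotLaw M hi, ← (hp t).map_eq, integral_map]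
    · rfl
    · exact (measurable_pi_apply t).aemeasurable
    · exact (Measurable.of_discrete).aestronglyMeasurable
  simp [h1]

theorem measure_moment_deviation_le {k : ℕ} (M : CoinModel k) {m i s : ℕ} (hi : i ≤ m)
    (hs : 0 < s) {η : ℝ} (hη : 0 < η) :
    M.sampleLaw m s {x | η ≤ |(∑ t, momentEstimator m i (x t)) / s - M.moment i|} ≤
      ENNReal.ofReal (1 / (s * η ^ 2)) := by
  have hs' : (0 : ℝ) < s := by exact_mod_cast hs
  have hL : MemLp (fun x : Fin s → ℕ => ∑ t, momentEstimator m i (x t)) 2 (M.sampleLaw m s) := by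
    refine MemLp.of_bound (Measurable.of_discrete).aestronglyMeasurable s
      (Filter.Eventually.of_forall fun x => ?_)
    rw [Real.norm_of_nonneg (Finset.sum_nonneg fun t _ => (momentEstimator_mem_Icc m i _).1)]
    refine (Finset.sum_le_card_nsmul _ _ 1 fun t _ => (momentEstimator_mem_Icc m i _).2).trans ?_
    simp
  have h := meas_ge_le_variance_div_sq hL (mul_pos hs' hη)
  rw [integral_sum_momentEstimator M hi] at h
  refine le_trans (measure_mono ?_) (h.trans (ENNReal.ofReal_le_ofReal ?_))
  · intro x hx
    rw [Set.mem_ofPred_eq] at hx ⊢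
    have : ∑ t, momentEstimator m i (x t) - s * M.moment i =
        s * ((∑ t, momentEstimator m i (x t)) / s - M.moment i) := by
      field_simp
    rw [this, abs_mul, abs_of_pos hs']
    gcongr
  · calc _ ≤ s / (s * η) ^ 2 := by
          gcongr
          exact variance_sum_momentEstimator_le M m i s
      _ = _ := by field_simp

/-- With large probability, all the empirical moments are close to the moments of the model,
and the empirical moment of order zero is exactly one. -/
theorem measureReal_moments_close {k : ℕ} (M : CoinModel k) {s : ℕ} (hs : 0 < s) {η : ℝ}
    (hη : 0 < η) (hsη : 100 * (2 * k + 1) ≤ s * η ^ 2) :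
    0.99 ≤ (M.sampleLaw (2 * k) s).real
      {x | (pascal k *ᵥ histogram (2 * k) x) 0 = 1 ∧
        ∀ i : Fin (2 * k + 1), |(pascal k *ᵥ histogram (2 * k) x) i - M.moment i| ≤ η} := by
  set P := M.sampleLaw (2 * k) s
  set S := {x : Fin s → ℕ | (pascal k *ᵥ histogram (2 * k) x) 0 = 1 ∧
        ∀ i : Fin (2 * k + 1), |(pascal k *ᵥ histogram (2 * k) x) i - M.moment i| ≤ η}
  have hs' : (0 : ℝ) < s := by exact_mod_cast hs
  have hA : P {x | ¬ ∀ t, x t ≤ 2 * k} = 0 := ae_iff.1 (ae_le_sampleLaw M (2 * k) s)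
  let B (i : Fin (2 * k + 1)) : Set (Fin s → ℕ) :=
    {x | η ≤ |(∑ t, momentEstimator (2 * k) i (x t)) / s - M.moment i|}
  have hsub : Sᶜ ⊆ {x | ¬ ∀ t, x t ≤ 2 * k} ∪ ⋃ i, B i := by
    intro x hx
    by_contra hcon
    simp only [Set.mem_union, Set.mem_iUnion, not_or, Set.mem_ofPred_eq, not_not, not_exists,
      B, not_le] at hcon
    apply hx
    refine ⟨?_, fun i => ?_⟩
    -- The order-zero estimator equals `1` on every snapshot that is at most `2k`, so this moment is
    -- exact off a null set.
    · rw [pascal_mulVec_histogram]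
      simp [momentEstimator, hcon.1, hs'.ne']
    · rw [pascal_mulVec_histogram]
      exact (hcon.2 i).le
  have hle : P Sᶜ ≤ ENNReal.ofReal (1 / 100) := by
    calc P Sᶜ ≤ _ := measure_mono hsub
      _ ≤ _ := measure_union_le _ _
      _ ≤ 0 + ∑ i, P (B i) := by
        gcongr
        · exact hA.le
        · exact measure_iUnion_fintype_le _ _
      _ ≤ 0 + ∑ i : Fin (2 * k + 1), ENNReal.ofReal (1 / (s * η ^ 2)) := by
        gcongr with i
        exact measure_moment_deviation_le M (Nat.lt_succ_iff.1 i.2) hs hη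
      _ = ENNReal.ofReal ((2 * k + 1) * (1 / (s * η ^ 2))) := by
        rw [zero_add, Finset.sum_const, Finset.card_univ, Fintype.card_fin, nsmul_eq_mul,
          ENNReal.ofReal_mul (by positivity)]
        congr 1
        rw [← ENNReal.ofReal_natCast]
        push_cast
        rfl
      _ ≤ _ := by
        apply ENNReal.ofReal_le_ofReal
        rw [mul_one_div, div_le_iff₀ (by positivity)]
        linarith
  have hS : MeasurableSet S := (Set.to_countable S).measurableSet
  have h1 : P.real Sᶜ ≤ 1 / 100 := ENNReal.toReal_le_of_le_ofReal (by norm_num) hle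
  rw [probReal_compl_eq_one_sub hS] at h1
  norm_num at h1 ⊢
  linarith

/-! ### Coefficient norms and Lagrange interpolation -/

open Polynomial in
/-- The sum of the absolute values of the coefficients of degree less than `n`. -/
def coeffNorm (n : ℕ) (p : ℝ[X]) : ℝ := ∑ i ∈ Finset.range n, |p.coeff i|

section CoeffNorm

open Polynomial

variable {n : ℕ} {p q : ℝ[X]}

theorem coeffNorm_nonneg : 0 ≤ coeffNorm n p := Finset.sum_nonneg fun _ _ => abs_nonneg _

theorem coeffNorm_add_le : coeffNorm n (p + q) ≤ coeffNorm n p + coeffNorm n q := by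
  unfold coeffNorm
  rw [← Finset.sum_add_distrib]
  gcongr
  rw [coeff_add]
  exact abs_add_le _ _

theorem coeffNorm_C_mul (c : ℝ) : coeffNorm n (C c * p) = |c| * coeffNorm n p := by
  simp [coeffNorm, abs_mul, Finset.mul_sum]

theorem coeffNorm_sum_le {ι : Type*} (s : Finset ι) (f : ι → ℝ[X]) :
    coeffNorm n (∑ i ∈ s, f i) ≤ ∑ i ∈ s, coeffNorm n (f i) := by
  classical
  induction s using Finset.induction_on with
  | empty => simp [coeffNorm]
  | insert a s ha ih =>
    rw [Finset.sum_insert ha, Finset.sum_insert ha]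
    exact coeffNorm_add_le.trans (by gcongr)

theorem coeffNorm_one_le : coeffNorm n 1 ≤ 1 := by
  cases n with
  | zero => simp [coeffNorm]
  | succ n =>
    rw [coeffNorm, Finset.sum_range_succ']
    simp [coeff_one]

/-- Multiplication by `X` shifts the coefficients and can only push the top one out of the range. -/
theorem coeffNorm_X_mul_le : coeffNorm n (X * p) ≤ coeffNorm n p := by
  cases n with
  | zero => simp [coeffNorm]
  | succ n =>
    rw [coeffNorm, Finset.sum_range_succ', coeffNorm, Finset.sum_range_succ]
    simp

theorem coeffNorm_C_mul_X_sub_C_mul_le {y : ℝ} (hy : y ∈ Set.Icc (0 : ℝ) 1) (c : ℝ) :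
    coeffNorm n (C c * (X - C y) * p) ≤ 2 * |c| * coeffNorm n p := by
  have h : C c * (X - C y) * p = C c * (X * p + C (-y) * p) := by
    rw [C_neg]; ring
  rw [h, coeffNorm_C_mul]
  have h1 := coeffNorm_add_le (n := n) (p := X * p) (q := C (-y) * p)
  rw [coeffNorm_C_mul, abs_neg, abs_of_nonneg hy.1] at h1
  have h2 := coeffNorm_X_mul_le (n := n) (p := p)
  have h3 : y * coeffNorm n p ≤ 1 * coeffNorm n p :=
    mul_le_mul_of_nonneg_right hy.2 coeffNorm_nonneg
  calc _ ≤ |c| * (2 * coeffNorm n p) := by gcongr; linarith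
    _ = _ := by ring

theorem coeffNorm_prod_le {ι : Type*} (s : Finset ι) (y c : ι → ℝ)
    (hy : ∀ i ∈ s, y i ∈ Set.Icc (0 : ℝ) 1) {B : ℝ} (hc : ∀ i ∈ s, |c i| ≤ B) :
    coeffNorm n (∏ i ∈ s, C (c i) * (X - C (y i))) ≤ (2 * B) ^ s.card := by
  classical
  induction s using Finset.induction_on with
  | empty => simpa using coeffNorm_one_le
  | insert a s ha ih =>
    have hB : 0 ≤ B := (abs_nonneg _).trans (hc a (Finset.mem_insert_self a s))
    rw [Finset.prod_insert ha, Finset.card_insert_of_notMem ha, pow_succ']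
    refine (coeffNorm_C_mul_X_sub_C_mul_le (hy a (Finset.mem_insert_self a s)) _).trans ?_
    have h1 := ih (fun i hi => hy i (Finset.mem_insert_of_mem hi))
      (fun i hi => hc i (Finset.mem_insert_of_mem hi))
    have h2 := hc a (Finset.mem_insert_self a s)
    gcongr
    exact coeffNorm_nonneg

variable {k : ℕ} {a : Fin k → I} {t : ℝ}

theorem injective_of_separated (ht : 0 < t)
    (ha : ∀ i j, i ≠ j → t ≤ |(a i : ℝ) - a j|) : Function.Injective fun i => (a i : ℝ) := by
  intro i j hij
  by_contra h
  have h1 := ha i j h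
  simp only at hij
  rw [hij, sub_self, abs_zero] at h1
  linarith

theorem coeffNorm_nodal_le : coeffNorm n (Lagrange.nodal Finset.univ fun i => (a i : ℝ)) ≤ 2 ^ k := by
  have h := coeffNorm_prod_le (n := n) Finset.univ (fun i => (a i : ℝ)) (fun _ => 1)
    (fun i _ => (a i).2) (B := 1) (by simp)
  simpa [Lagrange.nodal_eq] using h

theorem coeffNorm_basis_le (ht : 0 < t) (ha : ∀ i j, i ≠ j → t ≤ |(a i : ℝ) - a j|) (i : Fin k) :
    coeffNorm n (Lagrange.basis Finset.univ (fun i => (a i : ℝ)) i) ≤ (2 / t) ^ (k - 1) := by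
  have h := coeffNorm_prod_le (n := n) (Finset.univ.erase i) (fun j => (a j : ℝ))
    (fun j => ((a i : ℝ) - a j)⁻¹) (fun i _ => (a i).2) (B := 1 / t) (fun j hj => by
      rw [abs_inv, one_div]
      exact inv_anti₀ ht (ha i j (Finset.ne_of_mem_erase hj).symm))
  rw [Finset.card_erase_of_mem (Finset.mem_univ i), Finset.card_univ, Fintype.card_fin,
    mul_one_div] at h
  exact h

theorem sum_coeff_mul_pow {p : ℝ[X]} (hp : p.degree < n) (x : ℝ) :
    ∑ i ∈ Finset.range n, p.coeff i * x ^ i = p.eval x := by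
  rw [eval_eq_sum, Polynomial.sum_def]
  refine (Finset.sum_subset ?_ ?_).symm
  · intro i hi
    rw [Finset.mem_range]
    exact_mod_cast (le_degree_of_mem_supp i hi).trans_lt hp
  · intro i _ hi
    simp [notMem_support_iff.1 hi]

/-- A polynomial of degree at most `k` that is small at `k` separated points has a leading
coefficient that is not small. -/
theorem coeffNorm_le_of_eval_le (ht : 0 < t) (ha : ∀ i j, i ≠ j → t ≤ |(a i : ℝ) - a j|)
    {p : ℝ[X]} (hp : p.degree < (k + 1 : ℕ)) {δ : ℝ} (hδ : ∀ i, |p.eval (a i : ℝ)| ≤ δ) :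
    coeffNorm (k + 1) p ≤ |p.coeff k| * 2 ^ k + k * (δ * (2 / t) ^ (k - 1)) := by
  set x : Fin k → ℝ := fun i => (a i : ℝ)
  have hx : Set.InjOn x (Finset.univ : Finset (Fin k)) := (injective_of_separated ht ha).injOn
  set N := Lagrange.nodal Finset.univ x
  have hN : N.natDegree = k := by
    rw [Lagrange.natDegree_nodal, Finset.card_univ, Fintype.card_fin]
  have hNk : N.coeff k = 1 := by
    have := Lagrange.nodal_monic (s := Finset.univ) (v := x)
    rwa [Monic, leadingCoeff, hN] at this
  -- Subtracting this multiple of the nodal polynomial removes the degree `k` term without changing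
  -- the values at the nodes, so the rest is the interpolant of `p`.
  have hdeg : (p - C (p.coeff k) * N).degree < (Finset.univ : Finset (Fin k)).card := by
    rw [Finset.card_univ, Fintype.card_fin, degree_lt_iff_coeff_zero]
    intro m hm
    rw [coeff_sub, coeff_C_mul]
    rcases hm.eq_or_lt with rfl | hm
    · rw [hNk]; ring
    · rw [coeff_eq_zero_of_degree_lt (p := p) (hp.trans_le (by exact_mod_cast hm)),
        coeff_eq_zero_of_natDegree_lt (p := N) (by omega)]
      ring
  have h := Lagrange.eq_interpolate_of_eval_eq (fun i => p.eval (x i)) hx hdeg (fun i _ => by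
    rw [eval_sub, eval_mul, Lagrange.eval_nodal_at_node (Finset.mem_univ i)]; ring)
  rw [Lagrange.interpolate_apply] at h
  have h2 : p = C (p.coeff k) * N + ∑ i, C (p.eval (x i)) * Lagrange.basis Finset.univ x i := by
    rw [← h]; ring
  calc coeffNorm (k + 1) p ≤ coeffNorm (k + 1) (C (p.coeff k) * N) +
        coeffNorm (k + 1) (∑ i, C (p.eval (x i)) * Lagrange.basis Finset.univ x i) := by
        conv_lhs => rw [h2]
        exact coeffNorm_add_le
    _ ≤ |p.coeff k| * 2 ^ k + ∑ i : Fin k, δ * (2 / t) ^ (k - 1) := by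
        rw [coeffNorm_C_mul]
        gcongr
        · exact coeffNorm_nodal_le
        · refine (coeffNorm_sum_le _ _).trans ?_
          gcongr with i
          rw [coeffNorm_C_mul]
          gcongr
          · exact coeffNorm_nonneg
          · exact (abs_nonneg _).trans (hδ i)
          · exact hδ i
          · exact coeffNorm_basis_le ht ha i
    _ = _ := by simp

end CoeffNorm

/-! ### Polynomials of coefficient vectors and their factorization -/

section VectorPoly

open Polynomial

variable {n k : ℕ}

/-- The polynomial `∑ j, v j x ^ j` associated with a vector, over `ℝ`. -/
def realPoly (v : EuclideanSpace ℝ (Fin n)) : ℝ[X] := ∑ j : Fin n, monomial (j : ℕ) (v j)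

theorem vectorPoly_eq_map (v : EuclideanSpace ℝ (Fin n)) :
    vectorPoly v = (realPoly v).map Complex.ofRealHom := by
  simp [vectorPoly, realPoly, Polynomial.map_sum]

theorem realPoly_coeff (v : EuclideanSpace ℝ (Fin n)) (j : Fin n) :
    (realPoly v).coeff j = v j := by
  simp only [realPoly, finsetSum_coeff, coeff_monomial]
  rw [Finset.sum_eq_single j] <;> simp
  intro b hb hb'
  exact absurd (Fin.ext hb') hb

theorem realPoly_degree_lt (v : EuclideanSpace ℝ (Fin n)) : (realPoly v).degree < n := by
  rw [degree_lt_iff_coeff_zero]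
  intro m hm
  simp only [realPoly, finsetSum_coeff, coeff_monomial]
  refine Finset.sum_eq_zero fun j _ => if_neg ?_
  omega

theorem realPoly_eval (v : EuclideanSpace ℝ (Fin n)) (x : ℝ) :
    (realPoly v).eval x = ∑ j : Fin n, v j * x ^ (j : ℕ) := by
  simp [realPoly, eval_finsetSum]

theorem coeffNorm_realPoly (v : EuclideanSpace ℝ (Fin n)) :
    coeffNorm n (realPoly v) = ∑ j, |v j| := by
  rw [coeffNorm, ← Fin.sum_univ_eq_sum_range (fun i => |(realPoly v).coeff i|)]
  simp [realPoly_coeff]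

theorem norm_le_sum_abs (v : EuclideanSpace ℝ (Fin n)) : ‖v‖ ≤ ∑ j, |v j| := by
  have h : ‖v‖ ^ 2 ≤ (∑ j, |v j|) ^ 2 := by
    rw [EuclideanSpace.real_norm_sq_eq]
    calc ∑ j, v j ^ 2 = ∑ j, |v j| ^ 2 := by simp
      _ ≤ _ := Finset.sum_sq_le_sq_sum_of_nonneg fun _ _ => abs_nonneg _
  exact le_of_sq_le_sq h (Finset.sum_nonneg fun _ _ => abs_nonneg _)

theorem abs_apply_le_norm (v : EuclideanSpace ℝ (Fin n)) (j : Fin n) : |v j| ≤ ‖v‖ :=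
  PiLp.norm_apply_le v j

theorem sum_abs_le_mul_norm (v : EuclideanSpace ℝ (Fin n)) : ∑ j, |v j| ≤ n * ‖v‖ := by
  refine (Finset.sum_le_card_nsmul _ _ ‖v‖ fun j _ => abs_apply_le_norm v j).trans ?_
  simp

theorem natDegree_vectorPoly {v : EuclideanSpace ℝ (Fin (k + 1))}
    (hv : v (Fin.last k) ≠ 0) : (vectorPoly v).natDegree = k := by
  refine Polynomial.natDegree_eq_of_le_of_coeff_ne_zero ?_ ?_
  · rw [vectorPoly_eq_map]
    refine Polynomial.natDegree_map_le.trans ?_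
    rw [Polynomial.natDegree_le_iff_coeff_eq_zero]
    exact (Polynomial.degree_lt_iff_coeff_zero _ _).1 (realPoly_degree_lt v)
  · rw [vectorPoly_eq_map, Polynomial.coeff_map]
    have := realPoly_coeff v (Fin.last k)
    rw [Fin.val_last] at this
    rw [this]
    simpa using hv

theorem vectorPoly_eval_eq_prod {v : EuclideanSpace ℝ (Fin (k + 1))} (hv : v (Fin.last k) ≠ 0)
    {β : Fin k → ℂ} (hβ : (vectorPoly v).roots = Finset.univ.val.map β) (x : ℝ) :
    |(realPoly v).eval x| = |v (Fin.last k)| * ∏ j, ‖(x : ℂ) - β j‖ := by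
  have hc : (vectorPoly v).coeff k = (v (Fin.last k) : ℂ) := by
    rw [vectorPoly_eq_map, coeff_map]
    have := realPoly_coeff v (Fin.last k)
    rw [Fin.val_last] at this
    rw [this]; rfl
  have h := (IsAlgClosed.splits (vectorPoly v)).eval_eq_prod_roots (x : ℂ)
  rw [leadingCoeff, natDegree_vectorPoly hv, hc, hβ, Multiset.map_map] at h
  have h2 : (vectorPoly v).eval (x : ℂ) = (((realPoly v).eval x : ℝ) : ℂ) := by
    rw [vectorPoly_eq_map]
    exact eval_map_apply (f := Complex.ofRealHom) x
  rw [h2] at h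
  have h3 := congrArg norm h
  rw [Complex.norm_real, norm_mul, Complex.norm_real, Real.norm_eq_abs, Real.norm_eq_abs] at h3
  rw [h3]
  congr 1
  rw [← Complex.norm_prod]
  rfl

end VectorPoly

/-! ### Matching roots with biases -/

/-- If the product of the distances to the points `β j` is small at each of the separated points
`α i`, then the `β j` can be matched with the `α i`. -/
theorem exists_perm_of_prod_le {k : ℕ} {α : Fin k → ℝ} {β : Fin k → ℂ} {ζ B : ℝ} (hζ : 0 < ζ)
    (hα : ∀ i j, i ≠ j → ζ ≤ |α i - α j|) (hB : B ≤ (ζ / 8) ^ k)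
    (h : ∀ i, ∏ j, ‖(α i : ℂ) - β j‖ ≤ B) :
    ∃ τ : Equiv.Perm (Fin k), ∀ i, ‖(α i : ℂ) - β (τ i)‖ * (ζ / 2) ^ (k - 1) ≤ B := by
  -- If all factors exceeded `ζ/8`, their product would exceed `(ζ/8)^k ≥ B`.
  have h1 (i : Fin k) : ∃ j, ‖(α i : ℂ) - β j‖ ≤ ζ / 8 := by
    by_contra! hcon
    have : ∏ j : Fin k, ζ / 8 < ∏ j, ‖(α i : ℂ) - β j‖ :=
      Finset.prod_lt_prod_of_nonempty (fun j _ => by positivity) (fun j _ => hcon j)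
        ⟨i, Finset.mem_univ i⟩
    rw [Finset.prod_const, Finset.card_univ, Fintype.card_fin] at this
    linarith [h i]
  choose τ hτ using h1
  -- A root near one bias is at distance at least `ζ - ζ/8` from every other. This makes `τ`
  -- injective and bounds the remaining `k-1` factors of the product from below.
  have hsep (i j : Fin k) (hij : i ≠ j) : ζ / 2 ≤ ‖(α i : ℂ) - β (τ j)‖ := by
    have h2 : ‖(α i : ℂ) - α j‖ = |α i - α j| := by
      rw [← Complex.ofReal_sub, Complex.norm_real, Real.norm_eq_abs]
    have h3 := norm_sub_le_norm_sub_add_norm_sub (α i : ℂ) (β (τ j)) (α j)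
    rw [h2, norm_sub_rev (β (τ j))] at h3
    linarith [hα i j hij, hτ j]
  have hinj : Function.Injective τ := by
    intro i j hij
    by_contra hne
    have := hsep i j hne
    rw [← hij] at this
    linarith [hτ i]
  refine ⟨Equiv.ofBijective τ (Finite.injective_iff_bijective.1 hinj), fun i => ?_⟩
  refine le_trans ?_ (h i)
  rw [← Equiv.prod_comp (Equiv.ofBijective τ (Finite.injective_iff_bijective.1 hinj)),
    ← Finset.mul_prod_erase _ _ (Finset.mem_univ i)]
  gcongr
  calc (ζ / 2) ^ (k - 1) = ∏ j ∈ Finset.univ.erase i, ζ / 2 := by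
        rw [Finset.prod_const, Finset.card_erase_of_mem (Finset.mem_univ i), Finset.card_univ,
          Fintype.card_fin]
    _ ≤ _ := Finset.prod_le_prod (fun _ _ => by positivity)
        fun j hj => hsep i j (Finset.ne_of_mem_erase hj).symm

/-! ### Stability of the Vandermonde system -/

section Weights

open Polynomial

variable {k : ℕ} {a α : Fin k → I} {t d η : ℝ}

/-- Since `i ≠ j`, the factor with node `a j` occurs in the product and its numerator is at most
`d`. The other numerators are at most `1`, all points being in `[0,1]`. -/
theorem abs_eval_basis_le (ht : 0 < t) (ha : ∀ i j, i ≠ j → t ≤ |(a i : ℝ) - a j|)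
    (hd : ∀ i, |(α i : ℝ) - a i| ≤ d) {i j : Fin k} (hij : i ≠ j) :
    |(Lagrange.basis Finset.univ (fun i => (a i : ℝ)) i).eval (α j : ℝ)| ≤
      d * (1 / t) ^ (k - 1) := by
  rw [Lagrange.basis, eval_prod, Finset.abs_prod]
  have h (m : Fin k) (hm : m ∈ Finset.univ.erase i) :
      |(Lagrange.basisDivisor (a i : ℝ) (a m)).eval (α j : ℝ)| ≤
        (1 / t) * (if j = m then d else 1) := by
    rw [Lagrange.basisDivisor, eval_mul, eval_C, eval_sub, eval_X, eval_C, abs_mul, abs_inv,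
      one_div]
    gcongr
    · exact ha i m (Finset.ne_of_mem_erase hm).symm
    · split_ifs with hjm
      · exact hjm ▸ hd j
      · rw [abs_le]
        constructor <;> linarith [(α j).2.1, (α j).2.2, (a m).2.1, (a m).2.2]
  refine (Finset.prod_le_prod (fun _ _ => abs_nonneg _) h).trans_eq ?_
  rw [Finset.prod_mul_distrib, Finset.prod_const, Finset.card_erase_of_mem (Finset.mem_univ i),
    Finset.card_univ, Fintype.card_fin, Finset.prod_ite_eq,
    if_pos (Finset.mem_erase.2 ⟨hij.symm, Finset.mem_univ j⟩), mul_comm]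

/-- The basis polynomials sum to `1`, so the defect of the diagonal term is at most the off-diagonal
sum; hence the factor `2`. -/
theorem sum_abs_eval_basis_sub_le (ht : 0 < t) (ha : ∀ i j, i ≠ j → t ≤ |(a i : ℝ) - a j|)
    (hd : ∀ i, |(α i : ℝ) - a i| ≤ d) (j : Fin k) :
    ∑ i, |(Lagrange.basis Finset.univ (fun i => (a i : ℝ)) i).eval (α j : ℝ) -
      (if i = j then 1 else 0)| ≤ 2 * k * (d * (1 / t) ^ (k - 1)) := by
  set ℓ : Fin k → ℝ := fun i =>
    (Lagrange.basis Finset.univ (fun i => (a i : ℝ)) i).eval (α j : ℝ)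
  have hd0 : 0 ≤ d := (abs_nonneg _).trans (hd j)
  have h1 : ∑ i, ℓ i = 1 := by
    have := Lagrange.sum_basis (s := Finset.univ) (injective_of_separated ht ha).injOn
      ⟨j, Finset.mem_univ j⟩
    have h := congrArg (eval (α j : ℝ)) this
    rwa [eval_finsetSum, eval_one] at h
  have h2 : ∑ i ∈ Finset.univ.erase j, |ℓ i| ≤ k * (d * (1 / t) ^ (k - 1)) := by
    calc _ ≤ ∑ i ∈ Finset.univ.erase j, d * (1 / t) ^ (k - 1) :=
          Finset.sum_le_sum fun i hi =>
            abs_eval_basis_le ht ha hd (Finset.ne_of_mem_erase hi)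
      _ ≤ ∑ i : Fin k, d * (1 / t) ^ (k - 1) :=
          Finset.sum_le_sum_of_subset_of_nonneg (Finset.erase_subset _ _)
            fun _ _ _ => by positivity
      _ = _ := by simp
  rw [← Finset.add_sum_erase _ _ (Finset.mem_univ j)] at h1 ⊢
  have h3 : ∑ i ∈ Finset.univ.erase j, |ℓ i - (if i = j then 1 else 0)| =
      ∑ i ∈ Finset.univ.erase j, |ℓ i| :=
    Finset.sum_congr rfl fun i hi => by rw [if_neg (Finset.ne_of_mem_erase hi), sub_zero]
  have h4 : |ℓ j - 1| ≤ ∑ i ∈ Finset.univ.erase j, |ℓ i| := by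
    rw [← h1, sub_add_cancel_left, abs_neg]
    exact Finset.abs_sum_le_sum_abs _ _
  rw [h3, if_pos rfl]
  linarith

theorem sum_vandermondeWeights_mul_pow (ha : Function.Injective fun i => (a i : ℝ))
    (μ : Fin (2 * k + 1) → ℝ) (i : Fin k) :
    ∑ j, vandermondeWeights a μ j * (a j : ℝ) ^ (i : ℕ) = μ ⟨i, by omega⟩ := by
  set V := (Matrix.vandermonde fun i => (a i : ℝ))ᵀ
  have hdet : IsUnit V.det := by
    rw [Matrix.det_transpose, isUnit_iff_ne_zero, Matrix.det_vandermonde_ne_zero_iff]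
    exact ha
  have h : V *ᵥ vandermondeWeights a μ = fun i : Fin k => μ ⟨i, by omega⟩ := by
    rw [vandermondeWeights, Matrix.mulVec_mulVec, Matrix.mul_nonsing_inv _ hdet, Matrix.one_mulVec]
  rw [← congrFun h i]
  simp [V, Matrix.mulVec, dotProduct, Matrix.vandermonde, mul_comm]

theorem sum_vandermondeWeights (ha : Function.Injective fun i => (a i : ℝ)) (hk : 0 < k)
    (μ : Fin (2 * k + 1) → ℝ) : ∑ j, vandermondeWeights a μ j = μ 0 := by
  simpa using sum_vandermondeWeights_mul_pow ha μ ⟨0, hk⟩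

/-- The rows of the inverse are the Lagrange coefficient vectors: pairing `ℓ_i` with the moments of
a measure on the nodes evaluates `ℓ_i` there and isolates the `i`-th weight. -/
theorem vandermondeWeights_eq_sum_coeff (ha : Function.Injective fun i => (a i : ℝ))
    (μ : Fin (2 * k + 1) → ℝ) (i : Fin k) :
    vandermondeWeights a μ i =
      ∑ m : Fin k, (Lagrange.basis Finset.univ (fun i => (a i : ℝ)) i).coeff m *
        μ ⟨m, by omega⟩ := by
  have hdeg : (Lagrange.basis Finset.univ (fun i => (a i : ℝ)) i).degree < k := by
    rw [Lagrange.degree_basis ha.injOn (Finset.mem_univ i), Finset.card_univ, Fintype.card_fin]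
    have := i.2
    exact_mod_cast (by omega : k - 1 < k)
  simp_rw [← sum_vandermondeWeights_mul_pow ha μ, Finset.mul_sum]
  rw [Finset.sum_comm]
  have h (j : Fin k) : ∑ m : Fin k,
      (Lagrange.basis Finset.univ (fun i => (a i : ℝ)) i).coeff m *
        (vandermondeWeights a μ j * (a j : ℝ) ^ (m : ℕ)) =
      vandermondeWeights a μ j * (if i = j then 1 else 0) := by
    have h1 := sum_coeff_mul_pow hdeg (a j : ℝ)
    rw [← Fin.sum_univ_eq_sum_range (fun m =>
      (Lagrange.basis Finset.univ (fun i => (a i : ℝ)) i).coeff m * (a j : ℝ) ^ m)] at h1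
    have h2 : (Lagrange.basis Finset.univ (fun i => (a i : ℝ)) i).eval (a j : ℝ) =
        if i = j then 1 else 0 := by
      split_ifs with hij
      · subst hij
        exact Lagrange.eval_basis_self ha.injOn (Finset.mem_univ i)
      · exact Lagrange.eval_basis_of_ne (v := fun i => (a i : ℝ)) hij (Finset.mem_univ j)
    rw [← h2, ← h1, Finset.mul_sum]
    exact Finset.sum_congr rfl fun m _ => by ring
  simp [h]

/-- Stability of the weights obtained from the Vandermonde system. -/
theorem sum_abs_vandermondeWeights_sub_le (ht : 0 < t)
    (ha : ∀ i j, i ≠ j → t ≤ |(a i : ℝ) - a j|) (hd : ∀ i, |(α i : ℝ) - a i| ≤ d)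
    {w : Fin k → ℝ} (hw0 : ∀ i, 0 ≤ w i) (hw1 : ∑ i, w i = 1) {μ : Fin (2 * k + 1) → ℝ}
    (hμ : ∀ i, |μ i - ∑ j, w j * (α j : ℝ) ^ (i : ℕ)| ≤ η) :
    ∑ i, |vandermondeWeights a μ i - w i| ≤
      2 * k * (d * (1 / t) ^ (k - 1)) + k * ((2 / t) ^ (k - 1) * η) := by
  have hinj := injective_of_separated ht ha
  set ℓ : Fin k → ℝ[X] := fun i => Lagrange.basis Finset.univ (fun i => (a i : ℝ)) i
  have hη : 0 ≤ η := (abs_nonneg _).trans (hμ 0)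
  have hdeg (i : Fin k) : (ℓ i).degree < k := by
    rw [Lagrange.degree_basis hinj.injOn (Finset.mem_univ i), Finset.card_univ, Fintype.card_fin]
    have := i.2
    exact_mod_cast (by omega : k - 1 < k)
  -- The error splits into moment noise and the effect of replacing the nodes `α` by `a`.
  have h1 (i : Fin k) : vandermondeWeights a μ i - w i =
      ∑ m : Fin k, (ℓ i).coeff m * (μ ⟨m, by omega⟩ - ∑ j, w j * (α j : ℝ) ^ (m : ℕ)) +
        ∑ j, w j * ((ℓ i).eval (α j : ℝ) - if i = j then 1 else 0) := by
    have h2 : ∑ j, w j * (ℓ i).eval (α j : ℝ) =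
        ∑ m : Fin k, (ℓ i).coeff m * ∑ j, w j * (α j : ℝ) ^ (m : ℕ) := by
      simp_rw [← sum_coeff_mul_pow (hdeg i), Finset.mul_sum]
      rw [Finset.sum_comm]
      conv_lhs => rw [← Fin.sum_univ_eq_sum_range
        (fun m => ∑ j, w j * ((ℓ i).coeff m * (α j : ℝ) ^ m))]
      exact Finset.sum_congr rfl fun m _ => Finset.sum_congr rfl fun j _ => by ring
    rw [vandermondeWeights_eq_sum_coeff hinj]
    simp_rw [mul_sub, Finset.sum_sub_distrib, h2]
    simp [ℓ]
  have h3 (i : Fin k) :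
      |∑ m : Fin k, (ℓ i).coeff m * (μ ⟨m, by omega⟩ - ∑ j, w j * (α j : ℝ) ^ (m : ℕ))| ≤
        (2 / t) ^ (k - 1) * η := by
    refine (Finset.abs_sum_le_sum_abs _ _).trans ?_
    calc _ ≤ ∑ m : Fin k, |(ℓ i).coeff m| * η := by
          gcongr with m
          rw [abs_mul]
          gcongr
          exact hμ ⟨m, by omega⟩
      _ = coeffNorm k (ℓ i) * η := by
          rw [← Finset.sum_mul, coeffNorm, Fin.sum_univ_eq_sum_range (fun m => |(ℓ i).coeff m|)]
      _ ≤ _ := by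
          gcongr
          exact coeffNorm_basis_le ht ha i
  calc _ ≤ ∑ i, ((2 / t) ^ (k - 1) * η +
        ∑ j, w j * |(ℓ i).eval (α j : ℝ) - if i = j then 1 else 0|) := by
        gcongr with i
        rw [h1 i]
        refine (abs_add_le _ _).trans (add_le_add (h3 i) ?_)
        refine (Finset.abs_sum_le_sum_abs _ _).trans ?_
        gcongr with j
        rw [abs_mul, abs_of_nonneg (hw0 j)]
    _ = k * ((2 / t) ^ (k - 1) * η) +
        ∑ j, w j * ∑ i, |(ℓ i).eval (α j : ℝ) - if i = j then 1 else 0| := by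
        rw [Finset.sum_add_distrib, Finset.sum_comm]
        simp [Finset.mul_sum]
    _ ≤ k * ((2 / t) ^ (k - 1) * η) + ∑ j, w j * (2 * k * (d * (1 / t) ^ (k - 1))) := by
        gcongr with j
        · exact hw0 j
        · exact sum_abs_eval_basis_sub_le ht ha hd j
    _ = _ := by rw [← Finset.sum_mul, hw1]; ring

end Weights

/-! ### Rectification of the weights -/

section Rectify

variable {k : ℕ} {w u : Fin k → ℝ}

theorem sum_neg_add_sum_nonneg (w : Fin k → ℝ) :
    (∑ j with w j < 0, w j) + ∑ j with 0 ≤ w j, w j = ∑ j, w j := by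
  rw [← Finset.sum_filter_add_sum_filter_not Finset.univ (fun j => w j < 0)]
  simp

theorem sum_neg_nonpos (w : Fin k → ℝ) : ∑ j with w j < 0, w j ≤ 0 :=
  Finset.sum_nonpos fun _ hj => (Finset.mem_filter.1 hj).2.le

theorem rectifyWeights_factor_nonneg (hw : ∑ i, w i = 1) :
    0 ≤ 1 + (∑ j with w j < 0, w j) / (∑ j with 0 ≤ w j, w j) := by
  have h1 := sum_neg_add_sum_nonneg w
  have h2 := sum_neg_nonpos w
  have h3 : 0 < ∑ j with 0 ≤ w j, w j := by linarith
  rw [← sub_le_iff_le_add', zero_sub, le_div_iff₀ h3]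
  linarith

theorem rectifyWeights_nonneg (hw : ∑ i, w i = 1) (i : Fin k) : 0 ≤ rectifyWeights w i := by
  unfold rectifyWeights
  split_ifs with h
  · rfl
  · exact mul_nonneg (not_lt.1 h) (rectifyWeights_factor_nonneg hw)

theorem sum_rectifyWeights (hw : ∑ i, w i = 1) : ∑ i, rectifyWeights w i = 1 := by
  have h1 := sum_neg_add_sum_nonneg w
  have h2 := sum_neg_nonpos w
  have h3 : 0 < ∑ j with 0 ≤ w j, w j := by linarith
  simp only [rectifyWeights]
  rw [Finset.sum_ite, Finset.sum_const_zero, zero_add, ← Finset.sum_mul]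
  simp only [not_lt]
  field_simp
  linarith

/-- With total weight one, removing the negative mass `A` and rescaling moves exactly `2|A|` in
`ℓ¹`. As `u ≥ 0`, `|A|` is at most the original error, which gives the factor `3`. -/
theorem sum_abs_rectifyWeights_sub_le (hw : ∑ i, w i = 1) (hu : ∀ i, 0 ≤ u i) :
    ∑ i, |rectifyWeights w i - u i| ≤ 3 * ∑ i, |w i - u i| := by
  have h1 := sum_neg_add_sum_nonneg w
  have h2 := sum_neg_nonpos w
  set A := ∑ j with w j < 0, w j with hA
  set B := ∑ j with 0 ≤ w j, w j with hB
  have h3 : 0 < B := by linarith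
  have h4 : -A ≤ ∑ i, |w i - u i| := by
    rw [hA, ← Finset.sum_neg_distrib]
    calc _ ≤ ∑ j with w j < 0, |w j - u j| := by
          refine Finset.sum_le_sum fun j hj => ?_
          rw [abs_of_nonpos] <;> linarith [hu j, (Finset.mem_filter.1 hj).2]
      _ ≤ _ := Finset.sum_le_sum_of_subset_of_nonneg (Finset.filter_subset _ _)
          fun _ _ _ => abs_nonneg _
  have h5 : ∑ i, |rectifyWeights w i - w i| = -2 * A := by
    have (i : Fin k) : |rectifyWeights w i - w i| = if w i < 0 then -w i else w i * (-A / B) := by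
      unfold rectifyWeights
      split_ifs with h
      · rw [zero_sub, abs_neg, abs_of_neg h]
      · rw [← hA, ← hB, show w i * (1 + A / B) - w i = -(w i * (-A / B)) by ring, abs_neg,
          abs_of_nonneg (mul_nonneg (not_lt.1 h) (div_nonneg (by linarith) h3.le))]
    simp_rw [this]
    rw [Finset.sum_ite, ← Finset.sum_mul, Finset.sum_neg_distrib]
    simp only [not_lt]
    rw [← hA, ← hB]
    field_simp
    ring
  calc _ ≤ ∑ i, (|rectifyWeights w i - w i| + |w i - u i|) := by
        gcongr with i
        exact abs_sub_le _ _ _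
    _ ≤ _ := by
        rw [Finset.sum_add_distrib, h5]
        linarith

end Rectify

/-! ### Couplings of coin models -/

section Wasserstein

variable {k : ℕ}

theorem wasserstein_toMeasure_le_of_coupling (M M' : CoinModel k) {P : Fin k → Fin k → ℝ}
    (hP : ∀ i j, 0 ≤ P i j) (h1 : ∀ i, ∑ j, P i j = M.weight i)
    (h2 : ∀ j, ∑ i, P i j = M'.weight j) :
    wasserstein M.toMeasure M'.toMeasure ≤
      ENNReal.ofReal (∑ i, ∑ j, P i j * dist (M.bias i) (M'.bias j)) := by
  set π : Measure (I × I) := ∑ i, ∑ j, ENNReal.ofReal (P i j) •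
    Measure.dirac (M.bias i, M'.bias j)
  have hfst : π.fst = M.toMeasure := by
    rw [Measure.fst, Measure.map_finset_sum measurable_fst.aemeasurable, CoinModel.toMeasure]
    refine Finset.sum_congr rfl fun i _ => ?_
    rw [Measure.map_finset_sum measurable_fst.aemeasurable, ← h1,
      ENNReal.ofReal_sum_of_nonneg fun j _ => hP i j, Finset.sum_smul]
    refine Finset.sum_congr rfl fun j _ => ?_
    rw [Measure.map_smul, Measure.map_dirac' measurable_fst]
  have hsnd : π.snd = M'.toMeasure := by
    simp only [π]
    rw [Finset.sum_comm, Measure.snd, Measure.map_finset_sum measurable_snd.aemeasurable,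
      CoinModel.toMeasure]
    refine Finset.sum_congr rfl fun j _ => ?_
    rw [Measure.map_finset_sum measurable_snd.aemeasurable, ← h2,
      ENNReal.ofReal_sum_of_nonneg fun i _ => hP i j, Finset.sum_smul]
    refine Finset.sum_congr rfl fun i _ => ?_
    rw [Measure.map_smul, Measure.map_dirac' measurable_snd]
  refine (iInf₂_le_of_le π hfst (iInf_le _ hsnd)).trans ?_
  rw [lintegral_finsetSum_measure, ENNReal.ofReal_sum_of_nonneg
    fun i _ => Finset.sum_nonneg fun j _ => mul_nonneg (hP i j) dist_nonneg]
  refine Finset.sum_le_sum fun i _ => ?_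
  rw [lintegral_finsetSum_measure, ENNReal.ofReal_sum_of_nonneg
    fun j _ => mul_nonneg (hP i j) dist_nonneg]
  refine Finset.sum_le_sum fun j _ => ?_
  rw [lintegral_smul_measure, lintegral_dirac, ENNReal.ofReal_mul (hP i j), edist_dist,
    smul_eq_mul]

/-- Moving the biases by at most `d` and then changing the weights. -/
theorem wasserstein_toMeasure_le (M M' : CoinModel k) {d : ℝ}
    (hd : ∀ i, dist (M.bias i) (M'.bias i) ≤ d) :
    wasserstein M.toMeasure M'.toMeasure ≤
      ENNReal.ofReal (d + ∑ i, |M'.weight i - M.weight i|) := by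
  have hd0 : 0 ≤ d := by
    rcases Nat.eq_zero_or_pos k with rfl | hk
    · simpa using M.weight_sum
    · exact dist_nonneg.trans (hd ⟨0, hk⟩)
  -- The coupling keeps the common mass `c i` on the pair `(i, i)`, at cost at most `d` per unit,
  -- and couples the residuals `r`, `s` by their normalized product, at cost at most `1` per unit.
  set c : Fin k → ℝ := fun i => min (M.weight i) (M'.weight i)
  set r : Fin k → ℝ := fun i => M.weight i - c i
  set s : Fin k → ℝ := fun i => M'.weight i - c i
  have hc (i : Fin k) : 0 ≤ c i := le_min (M.weight_nonneg i) (M'.weight_nonneg i)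
  have hr (i : Fin k) : 0 ≤ r i := sub_nonneg.2 (min_le_left _ _)
  have hs (i : Fin k) : 0 ≤ s i := sub_nonneg.2 (min_le_right _ _)
  set T := ∑ i, r i with hT
  have hT' : T = ∑ i, s i := by
    simp only [hT, r, s, Finset.sum_sub_distrib, M.weight_sum, M'.weight_sum]
  have hT0 : 0 ≤ T := Finset.sum_nonneg fun i _ => hr i
  -- If `T = 0` then every residual vanishes, so the value `0` of division by zero is harmless.
  have hrT (i : Fin k) : r i * T / T = r i := by
    refine mul_div_cancel_of_imp fun h => ?_
    exact (Finset.sum_eq_zero_iff_of_nonneg fun i _ => hr i).1 h i (Finset.mem_univ i)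
  have hsT (i : Fin k) : s i * T / T = s i := by
    refine mul_div_cancel_of_imp fun h => ?_
    rw [hT'] at h
    exact (Finset.sum_eq_zero_iff_of_nonneg fun i _ => hs i).1 h i (Finset.mem_univ i)
  have hTle : T ≤ ∑ i, |M'.weight i - M.weight i| := by
    refine Finset.sum_le_sum fun i _ => ?_
    simp only [r, c]
    rcases le_total (M.weight i) (M'.weight i) with h | h
    · rw [min_eq_left h, sub_self]
      exact abs_nonneg _
    · rw [min_eq_right h, abs_sub_comm]
      exact le_abs_self _
  have hc1 : ∑ i, c i ≤ 1 := by
    rw [← M.weight_sum]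
    exact Finset.sum_le_sum fun i _ => min_le_left _ _
  have hrow (i : Fin k) : ∑ j, r i * s j / T = r i := by
    rw [← Finset.sum_div, ← Finset.mul_sum, ← hT', hrT]
  have h := wasserstein_toMeasure_le_of_coupling M M'
    (P := fun i j => (if i = j then c i else 0) + r i * s j / T)
    (fun i j => add_nonneg (by split_ifs; exacts [hc i, le_rfl])
      (div_nonneg (mul_nonneg (hr i) (hs j)) hT0))
    (fun i => by rw [Finset.sum_add_distrib, hrow]; simp [r])
    (fun j => by
      rw [Finset.sum_add_distrib, ← Finset.sum_div, ← Finset.sum_mul, ← hT, mul_comm T, hsT]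
      simp [s])
  refine h.trans (ENNReal.ofReal_le_ofReal ?_)
  calc _ ≤ ∑ i, ∑ j, ((if i = j then c i else 0) * d + r i * s j / T) := by
        gcongr with i _ j
        rw [add_mul]
        refine add_le_add ?_ (mul_le_of_le_one_right ?_ ?_)
        · split_ifs with hij
          · subst hij
            exact mul_le_mul_of_nonneg_left (hd i) (hc i)
          · simp
        · exact div_nonneg (mul_nonneg (hr i) (hs j)) hT0
        · rw [Subtype.dist_eq, Real.dist_eq, abs_le]
          constructor <;>
          linarith [(M.bias i).2.1, (M.bias i).2.2, (M'.bias j).2.1, (M'.bias j).2.2]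
    _ = (∑ i, c i) * d + T := by
        simp_rw [Finset.sum_add_distrib, hrow, ← Finset.sum_mul]
        simp [hT]
    _ ≤ _ := by
        refine add_le_add ?_ hTle
        exact mul_le_of_le_one_left hd0 hc1

/-- The model with its coins relabelled. -/
def CoinModel.permute (M : CoinModel k) (e : Equiv.Perm (Fin k)) : CoinModel k where
  bias := M.bias ∘ e
  weight := M.weight ∘ e
  weight_nonneg i := M.weight_nonneg (e i)
  weight_sum := (Equiv.sum_comp e M.weight).trans M.weight_sum

theorem CoinModel.permute_toMeasure (M : CoinModel k) (e : Equiv.Perm (Fin k)) :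
    (M.permute e).toMeasure = M.toMeasure :=
  Equiv.sum_comp e fun i => ENNReal.ofReal (M.weight i) • Measure.dirac (M.bias i)

theorem CoinModel.permute_moment (M : CoinModel k) (e : Equiv.Perm (Fin k)) (i : ℕ) :
    (M.permute e).moment i = M.moment i :=
  Equiv.sum_comp e fun j => M.weight j * (M.bias j : ℝ) ^ i

end Wasserstein

/-! ### Minimizers of the Hankel form -/

section Hankel

variable {k : ℕ}

theorem hankel_quadForm (μ : Fin (2 * k + 1) → ℝ) (z : Fin (k + 1) → ℝ) :
    z ⬝ᵥ (hankel μ *ᵥ z) =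
      ∑ i : Fin (k + 1), ∑ j : Fin (k + 1), z i * z j * μ ⟨(i : ℕ) + j, by omega⟩ := by
  simp only [dotProduct, Matrix.mulVec, hankel, Matrix.of_apply, Finset.mul_sum]
  exact Finset.sum_congr rfl fun i _ => Finset.sum_congr rfl fun j _ => by ring

theorem hankel_moment_quadForm (M : CoinModel k) (z : EuclideanSpace ℝ (Fin (k + 1))) :
    z.ofLp ⬝ᵥ (hankel (fun i : Fin (2 * k + 1) => M.moment i) *ᵥ z.ofLp) =
      ∑ l, M.weight l * (realPoly z).eval (M.bias l : ℝ) ^ 2 := by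
  rw [hankel_quadForm]
  simp only [CoinModel.moment, realPoly_eval, Finset.mul_sum]
  simp_rw [Finset.sum_comm (s := (Finset.univ : Finset (Fin (k + 1))))
    (t := (Finset.univ : Finset (Fin k)))]
  refine Finset.sum_congr rfl fun l _ => ?_
  rw [sq, Finset.sum_mul_sum, Finset.mul_sum]
  refine Finset.sum_congr rfl fun i _ => ?_
  rw [Finset.mul_sum]
  exact Finset.sum_congr rfl fun j _ => by rw [pow_add]; ring

theorem abs_hankel_quadForm_sub_le {μ ν : Fin (2 * k + 1) → ℝ} {η : ℝ}
    (h : ∀ i, |μ i - ν i| ≤ η) (z : Fin (k + 1) → ℝ) :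
    |z ⬝ᵥ (hankel μ *ᵥ z) - z ⬝ᵥ (hankel ν *ᵥ z)| ≤ η * (∑ i, |z i|) ^ 2 := by
  simp only [hankel_quadForm, ← Finset.sum_sub_distrib, ← mul_sub]
  calc _ ≤ ∑ i : Fin (k + 1), ∑ j : Fin (k + 1), |z i| * |z j| * η := by
        refine (Finset.abs_sum_le_sum_abs _ _).trans (Finset.sum_le_sum fun i _ => ?_)
        refine (Finset.abs_sum_le_sum_abs _ _).trans (Finset.sum_le_sum fun j _ => ?_)
        rw [abs_mul, abs_mul]
        gcongr
        exact h _
    _ = _ := by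
        rw [sq, Finset.sum_mul_sum, mul_comm, Finset.sum_mul]
        exact Finset.sum_congr rfl fun i _ => by rw [Finset.sum_mul]

/-- The coefficient vector of `∏ j, (x - α j)`, normalized, annihilates the true Hankel form. -/
theorem exists_unit_realPoly_eval_eq_zero (α : Fin k → ℝ) :
    ∃ z : EuclideanSpace ℝ (Fin (k + 1)), ‖z‖ = 1 ∧ ∀ i, (realPoly z).eval (α i) = 0 := by
  set N := Lagrange.nodal Finset.univ α
  have hN : N.natDegree = k := by
    rw [Lagrange.natDegree_nodal, Finset.card_univ, Fintype.card_fin]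
  have hNk : N.coeff k = 1 := by
    have := Lagrange.nodal_monic (s := Finset.univ) (v := α)
    rwa [Polynomial.Monic, Polynomial.leadingCoeff, hN] at this
  let q : EuclideanSpace ℝ (Fin (k + 1)) := WithLp.toLp 2 fun j => N.coeff j
  have hq : q ≠ 0 := by
    intro h
    have h1 : q (Fin.last k) = 0 := by rw [h]; rfl
    simp [q, hNk] at h1
  have hdeg : N.degree < (k + 1 : ℕ) := by
    rw [Lagrange.degree_nodal, Finset.card_univ, Fintype.card_fin]
    exact_mod_cast Nat.lt_succ_self k
  refine ⟨‖q‖⁻¹ • q, norm_smul_inv_norm hq, fun i => ?_⟩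
  rw [realPoly_eval]
  have h1 := sum_coeff_mul_pow hdeg (α i)
  rw [Lagrange.eval_nodal_at_node (Finset.mem_univ i),
    ← Fin.sum_univ_eq_sum_range (fun m => N.coeff m * α i ^ m)] at h1
  simp only [PiLp.smul_apply, smul_eq_mul, mul_assoc, ← Finset.mul_sum]
  simp [q, h1]

/-- A minimizer of a perturbed Hankel form gives a polynomial that is small at the biases. -/
theorem weight_mul_eval_sq_le (M : CoinModel k) {μ : Fin (2 * k + 1) → ℝ} {η : ℝ}
    (hμ : ∀ i, |μ i - M.moment i| ≤ η) {u : EuclideanSpace ℝ (Fin (k + 1))} (hu : ‖u‖ = 1)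
    (hmin : IsMinOn (fun z : EuclideanSpace ℝ (Fin (k + 1)) => z.ofLp ⬝ᵥ (hankel μ *ᵥ z.ofLp))
      (Metric.sphere 0 1) u) (l : Fin k) :
    M.weight l * (realPoly u).eval (M.bias l : ℝ) ^ 2 ≤ 2 * (k + 1) ^ 2 * η := by
  have hη : 0 ≤ η := (abs_nonneg _).trans (hμ 0)
  -- This `z` is a competitor on which the true form vanishes. Comparing it with `u` pays the
  -- perturbation error once for each vector, hence the factor `2`.
  obtain ⟨z, hz, hz0⟩ := exists_unit_realPoly_eval_eq_zero fun i => (M.bias i : ℝ)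
  have h1 : u.ofLp ⬝ᵥ (hankel μ *ᵥ u.ofLp) ≤ z.ofLp ⬝ᵥ (hankel μ *ᵥ z.ofLp) :=
    hmin (show z ∈ Metric.sphere (0 : EuclideanSpace ℝ (Fin (k + 1))) 1 by simpa using hz)
  have hdev (y : EuclideanSpace ℝ (Fin (k + 1))) (hy : ‖y‖ = 1) :
      |y.ofLp ⬝ᵥ (hankel μ *ᵥ y.ofLp) -
        ∑ l, M.weight l * (realPoly y).eval (M.bias l : ℝ) ^ 2| ≤ (k + 1) ^ 2 * η := by
    rw [← hankel_moment_quadForm]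
    refine (abs_hankel_quadForm_sub_le hμ y.ofLp).trans ?_
    rw [mul_comm]
    gcongr
    have := sum_abs_le_mul_norm y
    rw [hy, mul_one] at this
    exact_mod_cast this
  have h2 := abs_le.1 (hdev u hu)
  have h3 := abs_le.1 (hdev z hz)
  simp only [hz0] at h3
  have h4 : M.weight l * (realPoly u).eval (M.bias l : ℝ) ^ 2 ≤
      ∑ l, M.weight l * (realPoly u).eval (M.bias l : ℝ) ^ 2 :=
    Finset.single_le_sum
      (f := fun l => M.weight l * (realPoly u).eval (M.bias l : ℝ) ^ 2)
      (fun i _ => mul_nonneg (M.weight_nonneg i) (sq_nonneg _)) (Finset.mem_univ l)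
  simp only [ne_eq, OfNat.ofNat_ne_zero, not_false_eq_true, zero_pow, mul_zero,
    Finset.sum_const_zero] at h3
  linarith [h2.1, h2.2, h3.1, h3.2]

end Hankel

/-! ### Existence of an output -/

section Existence

theorem exists_isApproxArgmin {n : ℕ} {ε : ℝ} (hε : 0 ≤ ε)
    (H : Matrix (Fin (n + 1)) (Fin (n + 1)) ℝ) : ∃ v, IsApproxArgmin ε H v := by
  have hne : (Metric.sphere (0 : EuclideanSpace ℝ (Fin (n + 1))) 1).Nonempty :=
    ⟨EuclideanSpace.single 0 1, by simp⟩
  have hc : Continuous fun z : EuclideanSpace ℝ (Fin (n + 1)) => z.ofLp ⬝ᵥ (H *ᵥ z.ofLp) := by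
    simp only [dotProduct, Matrix.mulVec]
    fun_prop
  obtain ⟨u, hu, hmin⟩ := (isCompact_sphere _ _).exists_isMinOn hne hc.continuousOn
  exact ⟨u, u, hu, hmin, by simpa using hε⟩

theorem exists_fin_map_eq {α : Type*} {k : ℕ} (s : Multiset α) (hs : s.card = k) :
    ∃ β : Fin k → α, s = Finset.univ.val.map β := by
  induction s using Quotient.inductionOn with
  | h l =>
    have hl : l.length = k := hs
    subst hl
    refine ⟨l.get, ?_⟩
    rw [Fin.univ_val_map, List.ofFn_get]
    rfl

theorem exists_isApproxRoots {k : ℕ} {ε : ℝ} (hε : 0 ≤ ε)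
    (v : EuclideanSpace ℝ (Fin (k + 1))) : ∃ b, IsApproxRoots ε v b := by
  by_cases hv : v (Fin.last k) = 0
  · exact ⟨0, fun h => absurd hv h⟩
  · have hcard : (vectorPoly v).roots.card = k := by
      rw [(IsAlgClosed.splits (vectorPoly v)).natDegree_eq_card_roots.symm, natDegree_vectorPoly hv]
    obtain ⟨β, hβ⟩ := exists_fin_map_eq _ hcard
    exact ⟨β, fun _ => ⟨β, hβ, fun i => by simpa using hε⟩⟩

theorem exists_isOutput (k : ℕ) {ζ w : ℝ} (hζ : 0 ≤ ζ) (hw : 0 ≤ w) (γ : ℝ)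
    (h : Fin (2 * k + 1) → ℝ) : ∃ a b, IsOutput k ζ w γ h a b := by
  obtain ⟨v, hv⟩ := exists_isApproxArgmin (ε := w * 2 ^ (-γ) * (ζ / 16) ^ (2 * k))
    (by positivity) (hankel (pascal k *ᵥ h))
  obtain ⟨r, hr⟩ := exists_isApproxRoots (ε := 1 / (6 * k) * 2 ^ (-γ) * (ζ / 2) ^ k)
    (by positivity) v
  exact ⟨_, _, v, r, hv, hr, rfl, rfl⟩

end Existence

/-! ### Stability of the algorithm and the sample size -/

section Stability

variable {k : ℕ}

theorem abs_projUnit_sub_le (z : ℂ) (x : I) : |(projUnit z : ℝ) - x| ≤ ‖z - ((x : ℝ) : ℂ)‖ := by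
  have h := Set.abs_projIcc_sub_projIcc (a := (0 : ℝ)) (b := 1) (c := z.re) (d := (x : ℝ))
    zero_le_one
  rw [Set.projIcc_val] at h
  refine h.trans ?_
  have := Complex.abs_re_le_norm (z - ((x : ℝ) : ℂ))
  rwa [Complex.sub_re, Complex.ofReal_re] at this

theorem abs_realPoly_eval_sub_le {n : ℕ} (v u : EuclideanSpace ℝ (Fin n)) (x : I) :
    |(realPoly v).eval (x : ℝ) - (realPoly u).eval (x : ℝ)| ≤ n * dist v u := by
  rw [realPoly_eval, realPoly_eval, ← Finset.sum_sub_distrib, dist_eq_norm]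
  refine le_trans ?_ (sum_abs_le_mul_norm (v - u))
  refine (Finset.abs_sum_le_sum_abs _ _).trans (Finset.sum_le_sum fun j _ => ?_)
  rw [← sub_mul, abs_mul, abs_pow, abs_of_nonneg x.2.1]
  exact mul_le_of_le_one_right (abs_nonneg _) (pow_le_one₀ x.2.1 x.2.2)

/-- An empty family of weights cannot sum to `1`. -/
theorem CoinModel.pos (M : CoinModel k) : 0 < k := by
  rcases Nat.eq_zero_or_pos k with rfl | hk
  · simpa using M.weight_sum
  · exact hk

theorem CoinModel.le_weight (M : CoinModel k) {w : ℝ} (hw : w ≤ M.minWeight) (i : Fin k) :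
    w ≤ M.weight i :=
  hw.trans (ciInf_le (Set.finite_range _).bddBelow i)

/-- This lets the factor `w` in the tolerances absorb factors of order `k`. -/
theorem CoinModel.mul_le_one (M : CoinModel k) {w : ℝ} (hw : w ≤ M.minWeight) : k * w ≤ 1 := by
  rw [← M.weight_sum]
  simpa using Finset.card_nsmul_le_sum Finset.univ M.weight w fun i _ => M.le_weight hw i

theorem CoinModel.le_abs_sub (M : CoinModel k) {ζ : ℝ} (hζ : ENNReal.ofReal ζ ≤ M.separation)
    (i j : Fin k) (hij : i ≠ j) : ζ ≤ |(M.bias i : ℝ) - M.bias j| := by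
  have h : ENNReal.ofReal ζ ≤ edist (M.bias i) (M.bias j) :=
    hζ.trans (iInf₂_le_of_le i j (iInf_le _ hij))
  rw [edist_dist, ENNReal.ofReal_le_ofReal_iff dist_nonneg] at h
  exact h

/-- The accuracy of the empirical moments that the algorithm needs. -/
def momentTolerance (k : ℕ) (ζ w γ : ℝ) : ℝ :=
  w * ((2 : ℝ) ^ (-γ)) ^ 2 * (ζ / 16) ^ (4 * k) / 8 ^ k

theorem two_mul_succ_sq_le (hk : 0 < k) : 2 * ((k : ℝ) + 1) ^ 2 ≤ 8 ^ k := by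
  have h1 : ((k : ℝ) + 1) ≤ 2 ^ k := by exact_mod_cast Nat.lt_two_pow_self
  have h2 : (2 : ℝ) ≤ 2 ^ k := by simpa using pow_le_pow_right₀ (one_le_two (α := ℝ)) hk
  calc _ ≤ (2 : ℝ) ^ k * (2 ^ k) ^ 2 := by gcongr
    _ = _ := by rw [← pow_mul, mul_comm k 2, pow_mul, ← mul_pow]; norm_num

theorem pow_le_self_of_le_one {x : ℝ} (h0 : 0 ≤ x) (h1 : x ≤ 1) (hk : 0 < k) : x ^ k ≤ x :=
  pow_le_of_le_one h0 h1 hk.ne'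

variable {M : CoinModel k} {ζ w γ : ℝ} {μ : Fin (2 * k + 1) → ℝ}

/-- The polynomial of an approximate minimizer is small at the biases. -/
theorem abs_eval_bias_le (hζ0 : 0 < ζ) (hw0 : 0 < w) (hw : w ≤ M.minWeight)
    (hμ : ∀ i, |μ i - M.moment i| ≤ momentTolerance k ζ w γ)
    {v : EuclideanSpace ℝ (Fin (k + 1))}
    (hv : IsApproxArgmin (w * 2 ^ (-γ) * (ζ / 16) ^ (2 * k)) (hankel μ) v) (i : Fin k) :
    |(realPoly v).eval (M.bias i : ℝ)| ≤ 3 * (2 ^ (-γ) * (ζ / 16) ^ (2 * k)) := by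
  obtain ⟨u, hu, hmin, hvu⟩ := hv
  have hu1 : ‖u‖ = 1 := by simpa using hu
  have hg : (0 : ℝ) < 2 ^ (-γ) := by positivity
  have hkw := M.mul_le_one hw
  have hk : (1 : ℝ) ≤ k := by exact_mod_cast M.pos
  set δ := (2 : ℝ) ^ (-γ) * (ζ / 16) ^ (2 * k) with hδ
  have hδ0 : 0 < δ := by positivity
  have h1 := weight_mul_eval_sq_le M hμ hu1 hmin i
  -- The tolerance is `w δ^2 / 8^k`: the weight cancels `w`, and `8^k` absorbs `2(k+1)^2`.
  have hη : 2 * ((k : ℝ) + 1) ^ 2 * momentTolerance k ζ w γ ≤ w * δ ^ 2 := by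
    have : momentTolerance k ζ w γ = w * δ ^ 2 / 8 ^ k := by
      rw [momentTolerance, hδ, mul_pow, ← pow_mul]
      ring_nf
    rw [this, mul_div_assoc', div_le_iff₀ (by positivity), mul_comm]
    gcongr
    exact two_mul_succ_sq_le M.pos
  have h2 : (realPoly u).eval (M.bias i : ℝ) ^ 2 ≤ δ ^ 2 := by
    refine le_of_mul_le_mul_left ?_ hw0
    refine le_trans ?_ (h1.trans hη)
    gcongr
    exact M.le_weight hw i
  have h3 : |(realPoly u).eval (M.bias i : ℝ)| ≤ δ := abs_le_of_sq_le_sq h2 hδ0.le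
  have h4 := abs_realPoly_eval_sub_le v u (M.bias i)
  -- Passing from `u` to `v` costs `(k+1) w δ`, at most `2δ` because `k w ≤ 1`; with the `δ` for `u`
  -- this makes `3δ`.
  have h5 : ((k + 1 : ℕ) : ℝ) * dist v u ≤ 2 * δ := by
    calc _ ≤ ((k + 1 : ℕ) : ℝ) * (w * δ) := by
          gcongr
          rw [hδ, ← mul_assoc]
          exact hvu
      _ = (k * w + w) * δ := by push_cast; ring
      _ ≤ 2 * δ := by
          gcongr
          nlinarith
  have h6 := abs_sub_abs_le_abs_sub ((realPoly v).eval (M.bias i : ℝ))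
    ((realPoly u).eval (M.bias i : ℝ))
  linarith

theorem two_rpow_neg_le_half (hγ : 1 ≤ γ) : (2 : ℝ) ^ (-γ) ≤ 1 / 2 := by
  calc (2 : ℝ) ^ (-γ) ≤ 2 ^ (-1 : ℝ) :=
        Real.rpow_le_rpow_of_exponent_le one_le_two (by linarith)
    _ = 1 / 2 := by rw [Real.rpow_neg_one]; norm_num

/-- The leading coefficient of the polynomial of an approximate minimizer is not small. -/
theorem half_le_abs_last_mul (hζ0 : 0 < ζ) (hζ1 : ζ ≤ 1)
    (hζ : ENNReal.ofReal ζ ≤ M.separation) (hw0 : 0 < w) (hw : w ≤ M.minWeight) (hγ : 1 ≤ γ)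
    (hμ : ∀ i, |μ i - M.moment i| ≤ momentTolerance k ζ w γ)
    {v : EuclideanSpace ℝ (Fin (k + 1))}
    (hv : IsApproxArgmin (w * 2 ^ (-γ) * (ζ / 16) ^ (2 * k)) (hankel μ) v) :
    1 / 2 ≤ |v (Fin.last k)| * 2 ^ k := by
  have h1 := coeffNorm_le_of_eval_le hζ0 (M.le_abs_sub hζ) (realPoly_degree_lt v)
    (abs_eval_bias_le hζ0 hw0 hw hμ hv)
  have hlast := realPoly_coeff v (Fin.last k)
  rw [Fin.val_last] at hlast
  rw [coeffNorm_realPoly, hlast] at h1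
  have hg : (0 : ℝ) < 2 ^ (-γ) := by positivity
  have hg2 := two_rpow_neg_le_half hγ
  have hkw := M.mul_le_one hw
  have hk : (1 : ℝ) ≤ k := by exact_mod_cast M.pos
  have hw1 : w ≤ 1 := by nlinarith
  set δ := (2 : ℝ) ^ (-γ) * (ζ / 16) ^ (2 * k) with hδ
  have hδ0 : 0 < δ := by positivity
  have hδ1 : δ ≤ 1 / 16 := by
    have : (ζ / 16) ^ (2 * k) ≤ 1 / 16 :=
      (pow_le_self_of_le_one (by positivity) (by linarith) (by have := M.pos; omega)).trans
        (by linarith)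
    nlinarith
  obtain ⟨u, hu, -, hvu⟩ := hv
  have hu1 : ‖u‖ = 1 := by simpa using hu
  have h2 : 1 - δ ≤ ‖v‖ := by
    have h3 : ‖u‖ - ‖v‖ ≤ dist v u := by
      rw [dist_comm, dist_eq_norm]
      exact norm_sub_norm_le u v
    rw [mul_assoc, ← hδ] at hvu
    nlinarith
  -- The interpolation part accounts for at most `1/4` of an `ℓ¹` norm of at least `15/16`; the
  -- leading coefficient must supply the rest.
  have h4 : k * (3 * δ * (2 / ζ) ^ (k - 1)) ≤ 1 / 4 := by
    have h5 : (2 / ζ) ^ (k - 1) ≤ (2 / ζ) ^ k :=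
      pow_le_pow_right₀ ((one_le_div₀ hζ0).2 (by linarith)) (Nat.sub_le _ _)
    have h6 : (ζ / 16) ^ (2 * k) * (2 / ζ) ^ k = (ζ / 128) ^ k := by
      rw [pow_mul, ← mul_pow]
      congr 1
      field_simp
      norm_num
    have h7 : (k : ℝ) ≤ 2 ^ k := by exact_mod_cast Nat.lt_two_pow_self.le
    calc _ ≤ 2 ^ k * (3 * δ * (2 / ζ) ^ k) := by gcongr
      _ = 3 * 2 ^ (-γ) * (ζ / 64) ^ k := by
          rw [hδ, show (2 : ℝ) ^ k * (3 * (2 ^ (-γ) * (ζ / 16) ^ (2 * k)) * (2 / ζ) ^ k) =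
            3 * 2 ^ (-γ) * (2 ^ k * ((ζ / 16) ^ (2 * k) * (2 / ζ) ^ k)) by ring, h6, ← mul_pow]
          congr 2
          ring
      _ ≤ 3 * (1 / 2) * (1 / 64) := by
          gcongr
          exact (pow_le_self_of_le_one (by positivity) (by linarith) M.pos).trans (by linarith)
      _ ≤ 1 / 4 := by norm_num
  have h8 := norm_le_sum_abs v
  linarith

/-- Up to order, the computed biases are close to the biases of the model. -/
theorem exists_perm_abs_bias_sub_le (hζ0 : 0 < ζ) (hζ1 : ζ ≤ 1)
    (hζ : ENNReal.ofReal ζ ≤ M.separation) (hw0 : 0 < w) (hw : w ≤ M.minWeight) (hγ : 1 ≤ γ)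
    (hμ : ∀ i, |μ i - M.moment i| ≤ momentTolerance k ζ w γ)
    {v : EuclideanSpace ℝ (Fin (k + 1))}
    (hv : IsApproxArgmin (w * 2 ^ (-γ) * (ζ / 16) ^ (2 * k)) (hankel μ) v)
    {r : Fin k → ℂ} (hr : IsApproxRoots (1 / (6 * k) * 2 ^ (-γ) * (ζ / 2) ^ k) v r) :
    ∃ e : Equiv.Perm (Fin k), ∀ i,
      |(M.bias (e i) : ℝ) - projUnit (r i)| ≤ 2 ^ (-γ) * (ζ / 2) ^ k / 3 := by
  have hlead := half_le_abs_last_mul hζ0 hζ1 hζ hw0 hw hγ hμ hv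
  have hv0 : v (Fin.last k) ≠ 0 := by
    intro h
    rw [h, abs_zero, zero_mul] at hlead
    norm_num at hlead
  obtain ⟨β, hβ, hrβ⟩ := hr hv0
  have hg : (0 : ℝ) < 2 ^ (-γ) := by positivity
  have hg2 := two_rpow_neg_le_half hγ
  have hk : (1 : ℝ) ≤ k := by exact_mod_cast M.pos
  set g := (2 : ℝ) ^ (-γ)
  -- Dividing `3δ` by a leading coefficient of modulus at least `2^(-k)/2` gives `6 g (2
  -- ζ^2/256)^k`.
  have hprod (i : Fin k) : ∏ j, ‖((M.bias i : ℝ) : ℂ) - β j‖ ≤ 6 * g * (ζ ^ 2 / 128) ^ k := by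
    have h1 := abs_eval_bias_le hζ0 hw0 hw hμ hv i
    rw [vectorPoly_eval_eq_prod hv0 hβ] at h1
    set p := ∏ j, ‖((M.bias i : ℝ) : ℂ) - β j‖
    have hp : 0 ≤ p := Finset.prod_nonneg fun _ _ => norm_nonneg _
    have h2 : (ζ / 16) ^ (2 * k) * 2 ^ k = (ζ ^ 2 / 128) ^ k := by
      rw [pow_mul, ← mul_pow]
      congr 1
      ring
    calc p ≤ 2 * ((|v (Fin.last k)| * 2 ^ k) * p) := by nlinarith
      _ = 2 * 2 ^ k * (|v (Fin.last k)| * p) := by ring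
      _ ≤ 2 * 2 ^ k * (3 * (g * (ζ / 16) ^ (2 * k))) := by gcongr
      _ = 6 * g * ((ζ / 16) ^ (2 * k) * 2 ^ k) := by ring
      _ = _ := by rw [h2]
  have hB : 6 * g * (ζ ^ 2 / 128) ^ k ≤ (ζ / 8) ^ k := by
    have h1 : (ζ ^ 2 / 128) ^ k = (ζ / 16) ^ k * (ζ / 8) ^ k := by
      rw [← mul_pow]
      congr 1
      ring
    have h2 : (ζ / 16) ^ k ≤ 1 / 16 :=
      (pow_le_self_of_le_one (by positivity) (by linarith) M.pos).trans (by linarith)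
    rw [h1, ← mul_assoc]
    refine mul_le_of_le_one_left (by positivity) ?_
    calc _ ≤ 6 * (1 / 2) * (1 / 16 : ℝ) := by gcongr
      _ ≤ 1 := by norm_num
  obtain ⟨τ, hτ⟩ := exists_perm_of_prod_le hζ0 (M.le_abs_sub hζ) hB hprod
  have hclose (i : Fin k) : ‖((M.bias i : ℝ) : ℂ) - β (τ i)‖ ≤ g * (ζ / 2) ^ k / 6 := by
    -- Writing `ζ^2/128 = (1/32)(ζ/2)^2` exposes the factor `(ζ/2)^(k-1)` to cancel against the
    -- other roots.
    have h1 : 6 * g * (ζ ^ 2 / 128) ^ k =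
        6 * g * (ζ / 2) * (1 / 32) ^ k * (ζ / 2) ^ k * (ζ / 2) ^ (k - 1) := by
      obtain ⟨m, rfl⟩ := Nat.exists_eq_succ_of_ne_zero M.pos.ne'
      have : ζ ^ 2 / 128 = (1 / 32) * (ζ / 2) * (ζ / 2) := by ring
      rw [this, mul_pow, mul_pow, Nat.succ_eq_add_one, Nat.add_sub_cancel, pow_succ (ζ / 2) m]
      ring
    have h2 := hτ i
    rw [h1] at h2
    have h3 := le_of_mul_le_mul_right h2 (by positivity)
    refine h3.trans ?_
    have h4 : ((1 : ℝ) / 32) ^ k ≤ 1 / 32 :=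
      pow_le_self_of_le_one (by norm_num) (by norm_num) M.pos
    calc _ ≤ 6 * g * (1 / 2) * (1 / 32) * (ζ / 2) ^ k := by gcongr
      _ ≤ _ := by nlinarith [mul_pos hg (pow_pos (half_pos hζ0) k)]
  refine ⟨τ.symm, fun i => ?_⟩
  rw [abs_sub_comm]
  refine (abs_projUnit_sub_le _ _).trans ?_
  have h1 := hclose (τ.symm i)
  rw [Equiv.apply_symm_apply, norm_sub_rev] at h1
  have h2 := norm_sub_le_norm_sub_add_norm_sub (r i) (β i) ((M.bias (τ.symm i) : ℝ) : ℂ)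
  -- The root-finding error is at most another `g (ζ/2)^k / 6`, for a total of one third.
  have h3 : 1 / (6 * k) * g * (ζ / 2) ^ k ≤ g * (ζ / 2) ^ k / 6 := by
    have : 1 / (6 * (k : ℝ)) ≤ 1 / 6 := by
      gcongr
      linarith
    calc _ ≤ 1 / 6 * g * (ζ / 2) ^ k := by gcongr
      _ = _ := by ring
  linarith [hrβ i]

/-- Every output on input moments that are close to those of the model is close to the model. -/
theorem exists_model_of_isOutput (hζ0 : 0 < ζ) (hζ1 : ζ ≤ 1)
    (hζ : ENNReal.ofReal ζ ≤ M.separation) (hw0 : 0 < w) (hw : w ≤ M.minWeight) (hγ : 1 ≤ γ)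
    {h : Fin (2 * k + 1) → ℝ} (hμ0 : (pascal k *ᵥ h) 0 = 1)
    (hμ : ∀ i, |(pascal k *ᵥ h) i - M.moment i| ≤ momentTolerance k ζ w γ)
    {a : Fin k → I} {b : Fin k → ℝ} (hab : IsOutput k ζ w γ h a b) :
    ∃ M' : CoinModel k, M'.bias = a ∧ M'.weight = b ∧
      wasserstein M.toMeasure M'.toMeasure ≤ ENNReal.ofReal ((k + 1) * 2 ^ (-γ)) := by
  obtain ⟨v, r, hv, hr, rfl, rfl⟩ := hab
  set μ := pascal k *ᵥ h
  set a : Fin k → I := fun i => projUnit (r i)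
  obtain ⟨e, he⟩ := exists_perm_abs_bias_sub_le hζ0 hζ1 hζ hw0 hw hγ hμ hv hr
  have hg : (0 : ℝ) < 2 ^ (-γ) := by positivity
  have hg2 := two_rpow_neg_le_half hγ
  have hk : (1 : ℝ) ≤ k := by exact_mod_cast M.pos
  have hkw := M.mul_le_one hw
  set g := (2 : ℝ) ^ (-γ) with hgdef
  set d := g * (ζ / 2) ^ k / 3 with hd
  have hpow : (ζ / 2) ^ k ≤ ζ / 2 := pow_le_self_of_le_one (by positivity) (by linarith) M.pos
  have hdle : d ≤ g * (ζ / 2) / 3 := by rw [hd]; gcongr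
  -- Each bias moves by at most `ζ/12`, so the computed biases keep separation `ζ/2`, and the
  -- Vandermonde bounds apply to them.
  have hsep (i j : Fin k) (hij : i ≠ j) : ζ / 2 ≤ |(a i : ℝ) - a j| := by
    have h1 := M.le_abs_sub hζ (e i) (e j) (e.injective.ne hij)
    have h2 := he i
    have h3 := he j
    rw [abs_sub_comm] at h3
    have h4 := abs_add_three ((M.bias (e i) : ℝ) - a i) ((a i : ℝ) - a j)
      ((a j : ℝ) - M.bias (e j))
    rw [show ((M.bias (e i) : ℝ) - a i) + ((a i : ℝ) - a j) + ((a j : ℝ) - M.bias (e j)) =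
      (M.bias (e i) : ℝ) - M.bias (e j) by ring] at h4
    have h5 : d ≤ ζ / 12 := by nlinarith
    linarith
  have ht : 0 < ζ / 2 := by positivity
  have hsum : ∑ i, vandermondeWeights a μ i = 1 :=
    (sum_vandermondeWeights (injective_of_separated ht hsep) M.pos μ).trans hμ0
  have hE := sum_abs_vandermondeWeights_sub_le (α := (M.permute e).bias) ht hsep he
    (M.permute e).weight_nonneg (M.permute e).weight_sum (μ := μ)
    (η := momentTolerance k ζ w γ) (fun i => by
      have := hμ i
      rwa [← M.permute_moment e] at this)
  have hR := sum_abs_rectifyWeights_sub_le hsum (M.permute e).weight_nonneg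
  refine ⟨⟨a, _, rectifyWeights_nonneg hsum, sum_rectifyWeights hsum⟩, rfl, rfl, ?_⟩
  rw [← M.permute_toMeasure e]
  refine (wasserstein_toMeasure_le _ _ (d := d) he).trans (ENNReal.ofReal_le_ofReal ?_)
  -- The factor `(ζ/2)^k` in `d` cancels the amplification `(2/ζ)^(k-1)`.
  have hD : d * (1 / (ζ / 2)) ^ (k - 1) ≤ g / 6 := by
    obtain ⟨m, hm⟩ := Nat.exists_eq_succ_of_ne_zero M.pos.ne'
    have : (ζ / 2) ^ k * (1 / (ζ / 2)) ^ (k - 1) = ζ / 2 := by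
      rw [hm, Nat.succ_eq_add_one, Nat.add_sub_cancel, pow_succ, mul_right_comm, ← mul_pow,
        mul_one_div_cancel ht.ne', one_pow, one_mul]
    calc _ = g / 3 * ((ζ / 2) ^ k * (1 / (ζ / 2)) ^ (k - 1)) := by rw [hd]; ring
      _ = g / 3 * (ζ / 2) := by rw [this]
      _ ≤ g / 3 * (1 / 2) := by gcongr
      _ = _ := by ring
  have hη : k * ((2 / (ζ / 2)) ^ (k - 1) * momentTolerance k ζ w γ) ≤ g / 8 := by
    have h1 : (2 / (ζ / 2)) ^ (k - 1) ≤ (4 / ζ) ^ k := by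
      rw [show 2 / (ζ / 2) = 4 / ζ by field_simp; norm_num]
      exact pow_le_pow_right₀ ((one_le_div₀ hζ0).2 (by linarith)) (Nat.sub_le _ _)
    have h2 : (4 / ζ) ^ k * ((ζ / 16) ^ (4 * k) / 8 ^ k) ≤ 1 / 4 := by
      rw [pow_mul, ← div_pow, ← mul_pow]
      have : 4 / ζ * ((ζ / 16) ^ 4 / 8) = ζ ^ 3 / 131072 := by
        field_simp
        norm_num
      have h3 : ζ ^ 3 ≤ 1 := pow_le_one₀ hζ0.le hζ1
      rw [this]
      exact (pow_le_self_of_le_one (by positivity) (by linarith) M.pos).trans (by linarith)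
    have hT : 0 ≤ momentTolerance k ζ w γ := by
      unfold momentTolerance
      positivity
    calc _ ≤ k * ((4 / ζ) ^ k * momentTolerance k ζ w γ) := by gcongr
      _ = (k * w) * g ^ 2 * ((4 / ζ) ^ k * ((ζ / 16) ^ (4 * k) / 8 ^ k)) := by
          rw [momentTolerance, ← hgdef]
          ring
      _ ≤ 1 * g ^ 2 * (1 / 4) := by gcongr
      _ ≤ g / 8 := by nlinarith
  have hE' : ∑ i, |vandermondeWeights a μ i - (M.permute e).weight i| ≤ k * g / 3 + g / 8 := by
    refine hE.trans ?_
    have : 2 * k * (d * (1 / (ζ / 2)) ^ (k - 1)) ≤ 2 * k * (g / 6) := by gcongr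
    linarith
  have hd6 : d ≤ g / 6 := by nlinarith
  simp only at hR ⊢
  -- The total is at most `g/6 + 3 (k g/3 + g/8) = (k + 13/24) g`.
  linarith

/-- The sample size bound of the main theorem suffices for the empirical moments. -/
theorem sample_size_bound (hk : 0 < k) (hζ0 : 0 < ζ) (hζ1 : ζ ≤ 1) (hw0 : 0 < w) (hγ : 1 ≤ γ)
    {s : ℝ} (hs : w⁻¹ ^ 2 * (2 : ℝ) ^ (40 * (k + γ)) * ζ⁻¹ ^ (40 * (k : ℝ)) ≤ s) :
    100 * (2 * k + 1) ≤ s * momentTolerance k ζ w γ ^ 2 := by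
  set G := (2 : ℝ) ^ γ with hG
  have hG2 : 2 ≤ G := by
    simpa using Real.rpow_le_rpow_of_exponent_le (one_le_two (α := ℝ)) hγ
  have hg : (2 : ℝ) ^ (-γ) = G⁻¹ := Real.rpow_neg zero_le_two γ
  have h1 : (2 : ℝ) ^ (40 * ((k : ℝ) + γ)) = (2 ^ 40) ^ k * G ^ 40 := by
    rw [show 40 * ((k : ℝ) + γ) = ((40 * k : ℕ) : ℝ) + γ * (40 : ℕ) by push_cast; ring,
      Real.rpow_add two_pos, Real.rpow_natCast, Real.rpow_mul_natCast zero_le_two, pow_mul]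
  have h2 : ζ⁻¹ ^ (40 * (k : ℝ)) = (ζ⁻¹ ^ 40) ^ k := by
    rw [Real.rpow_mul (by positivity), Real.rpow_natCast]
    norm_cast
  rw [h1, h2] at hs
  have hpos : 0 < G := by linarith
  have hζ' : 1 ≤ ζ⁻¹ := (one_le_inv₀ hζ0).2 hζ1
  have h3 : momentTolerance k ζ w γ ^ 2 = w ^ 2 * (G⁻¹) ^ 4 * ((ζ / 16) ^ 8 / 64) ^ k := by
    rw [momentTolerance, hg, pow_mul, mul_div_assoc, ← div_pow, mul_pow, mul_pow, ← pow_mul,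
      ← pow_mul, mul_comm k 2, pow_mul _ 2 k]
    congr 2
    ring
  have h4 : (2 * k + 1 : ℝ) ≤ 4 ^ k := by
    have h5 := one_add_mul_le_pow (a := (3 : ℝ)) (by norm_num) k
    norm_num at h5
    linarith [(Nat.cast_nonneg k : (0 : ℝ) ≤ k)]
  -- The exponent `40` leaves room: `2^40 · 16^(-8) / 64 = 4`, whose `k`-th power dominates `2k+1`,
  -- while `G^36 ≥ 2^36` dominates `100`.
  have h6 : (4 : ℝ) ≤ 2 ^ 40 * ζ⁻¹ ^ 40 * ((ζ / 16) ^ 8 / 64) := by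
    have : 2 ^ 40 * ζ⁻¹ ^ 40 * ((ζ / 16) ^ 8 / 64) = 4 * ζ⁻¹ ^ 32 := by
      field_simp
      norm_num
    rw [this]
    linarith [one_le_pow₀ hζ' (n := 32)]
  calc 100 * (2 * k + 1 : ℝ) ≤ 2 ^ 36 * 4 ^ k := by
        refine mul_le_mul (by norm_num) h4 (by positivity) (by positivity)
    _ ≤ G ^ 36 * (2 ^ 40 * ζ⁻¹ ^ 40 * ((ζ / 16) ^ 8 / 64)) ^ k := by gcongr
    _ = (w⁻¹ ^ 2 * ((2 ^ 40) ^ k * G ^ 40) * (ζ⁻¹ ^ 40) ^ k) * momentTolerance k ζ w γ ^ 2 := by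
        rw [h3, mul_pow, mul_pow]
        field_simp
    _ ≤ _ := by gcongr

end Stability

end CoinMixture

end

theorem mainTheorem6 :
    ∃ C : ℝ, 0 < C ∧
      ∀ (k : ℕ) (M : CoinMixture.CoinModel k) (ζ w γ : ℝ),
        0 < ζ → ζ ≤ 1 → ENNReal.ofReal ζ ≤ M.separation →
        0 < w → w ≤ M.minWeight →
        1 ≤ γ →
        ∀ s : ℕ, w⁻¹ ^ 2 * (2 : ℝ) ^ (C * (k + γ)) * ζ⁻¹ ^ (C * k) ≤ (s : ℝ) →
          0.99 ≤ (M.sampleLaw (2 * k) s).real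
            {x | (∃ a b, CoinMixture.IsOutput k ζ w γ (CoinMixture.histogram (2 * k) x) a b) ∧
              ∀ a b, CoinMixture.IsOutput k ζ w γ (CoinMixture.histogram (2 * k) x) a b →
                ∃ M' : CoinMixture.CoinModel k, M'.bias = a ∧ M'.weight = b ∧
                  CoinMixture.wasserstein M.toMeasure M'.toMeasure ≤
                    ENNReal.ofReal ((k + 1) * 2 ^ (-γ))} := by
  refine ⟨40, by norm_num, fun k M ζ w γ hζ0 hζ1 hζ hw0 hw hγ s hs => ?_⟩
  have hs0 : 0 < s := by
    have : (0 : ℝ) < s := lt_of_lt_of_le (by positivity) hs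
    exact_mod_cast this
  have hη : 0 < CoinMixture.momentTolerance k ζ w γ := by
    unfold CoinMixture.momentTolerance
    positivity
  refine (CoinMixture.measureReal_moments_close M hs0 hη
    (CoinMixture.sample_size_bound M.pos hζ0 hζ1 hw0 hγ hs)).trans
      (MeasureTheory.measureReal_mono ?_)
  rintro x ⟨hx0, hx⟩
  exact ⟨CoinMixture.exists_isOutput k hζ0.le hw0.le γ _, fun a b hab =>
    CoinMixture.exists_model_of_isOutput hζ0 hζ1 hζ hw0 hw hγ hx0 hx hab⟩
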